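/- \textbf{Definitions.} A \emph{scalable group} is a topological group $G$ with a continuous map $\delta:\mathbb R\times G\to G$ such that $\delta_\lambda=\delta(\lambda,\cdot)$ is an automorphism of $G$ for every $\lambda\neq0$, $\delta_\lambda\circ\delta_\mu=\delta_{\lambda\mu}$ for all $\lambda,\mu\in\mathbb R$, and $\delta_0\equiv e_G$. A \emph{scalable subgroup} is a closed subgroup $H$ with $\delta_\lambda(H)=H$ for all $\lambda\ne0$. A (finite-dimensional) \emph{Carnot group} is a simply connected Lie group whose Lie algebra has a stratification $V_1\oplus\dots\oplus V_s$, $[V_1,V_k]=V_{k+1}$ for $1\le k\le s$ with $V_{s+1}=0$, with the dilations induced by multiplication by $\lambda^k$ on $V_k$; equivalently, up to isomorphism, it is a finite-dimensional real stratified Lie algebra with the Baker--Campbell--Dynkin--Hausdorff product and these linear dilations. A scalable subgroup $H$ of $G$ is a \emph{Carnot subgroup} if $(H,\delta|_H)$ is isomorphic to a Carnot group as a topological group with dilations. A \emph{filtration} of $G$ by Carnot subgroups is an increasing (not necessarily strictly) sequence of Carnot subgroups whose union is dense in $G$. An \emph{infinite-dimensional Carnot group} is a scalable group $G$ that admits a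 filtration by Carnot subgroups, with a complete left-invariant metric $d$ that induces its topology and satisfies $d(\delta_t p,\delta_t q)=|t|\,d(p,q)$ for all $t\in\mathbb R$, $p,q\in G$. (Finite-dimensional Carnot groups are not excluded.) Let $V_1(G)$ be the set of $p\in G$ such that $t\mapsto\delta_t(p)$ is a one-parameter subgroup. For a sequence $\mathcal X=(X_1,X_2,\dots)$ in $V_1(G)$, let $H_i$ be the closure of the group generated by $\{\delta_t(X_j):1\le j\le i,\ t\in\mathbb R\}$. The sequence $\mathcal X$ is a \emph{Carnot-spanning set} if $(H_i)_{i\ge1}$ is a filtration of $G$ by Carnot subgroups. For $Y\in V_1(G)$, let $\mathcal A(Y)$ be the class of Borel sets $F\subseteq G$ such that $\{t\in\mathbb R: g\,\delta_t(Y)\in F\}$ has Lebesgue measure zero for every $g\in G$. A Borel set $E\subseteq G$ is \emph{Aronszajn null} if for every Carnot-spanning set $\mathcal X=(X_1,X_2,\dots)$ it can be written as $E=\bigcup_{i\ge1}E_i$ with Borel sets $E_i\in\mathcal A(X_i)$. For a Carnot-spanning set $\mathcal X$ with subgroups $H_k$, let $\mathrm{CAC}'(\mathcal X)$ be the set of Borel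 probability measures $\mu$ on $G$ for which there are probability measures $\nu_k$ on $H_k$ ($k\ge1$), absolutely continuous with respect to Haar measure on $H_k$ and regarded as measures on $G$, such that for every $m\ge1$ the sequence $(\nu_k*\nu_{k-1}*\dots*\nu_m)_{k\ge m}$ converges weakly to some probability measure as $k\to\infty$, and the sequence $(\nu_k*\dots*\nu_1)_{k\ge1}$ converges weakly to $\mu$. A Borel set $E\subseteq G$ is \emph{CAC null} if $\mu(g^{-1}E)=0$ for every $g\in G$, every Carnot-spanning set $\mathcal X$ and every $\mu\in\mathrm{CAC}'(\mathcal X)$. \textbf{Theorem.} Let $G$ be an infinite-dimensional Carnot group and let $E\subseteq G$ be a Borel set. Then $E$ is Aronszajn null if and only if it is CAC null. -/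

import Mathlib

open MeasureTheory Filter Topology
open scoped BoundedContinuousFunction

noncomputable section

/-! ### Finite-dimensional Carnot groups -/

/-- The right-nested bracket `⁅a₁, ⁅a₂, … ⁅aₙ₋₁, aₙ⁆ … ⁆⁆` of a list. -/
def nestedBracket {L : Type*} [LieRing L] : List L → L
  | [] => 0
  | [a] => a
  | a :: b :: l => ⁅a, nestedBracket (b :: l)⁆

/-- The Baker-Campbell-Dynkin-Hausdorff product of `x` and `y` in a nilpotent real Lie algebra of
step at most `N`, by Dynkin's formula: the sum over `1 ≤ k` and over pairs
`p i = (rᵢ, sᵢ) ≠ (0, 0)`, `i < k`, of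
`(-1) ^ (k - 1) / k * (∑ᵢ (rᵢ + sᵢ))⁻¹ * (∏ᵢ rᵢ! sᵢ!)⁻¹`
times the nested bracket of the word `x ^ r₁ y ^ s₁ ⋯ x ^ rₖ y ^ sₖ`. Words of length larger than `N`
have bracket zero, so it is enough to let `k`, `rᵢ` and `sᵢ` range up to `N`. -/
def bch {L : Type*} [LieRing L] [LieAlgebra ℝ L] (N : ℕ) (x y : L) : L :=
  ∑ k ∈ Finset.Icc 1 N, ((-1 : ℝ) ^ (k - 1) / (k : ℝ)) •
    ∑ p ∈ Fintype.piFinset (fun _ : Fin k =>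
        (Finset.range (N + 1) ×ˢ Finset.range (N + 1)).filter (fun q : ℕ × ℕ => q ≠ (0, 0))),
      ((((∑ i, ((p i).1 + (p i).2) : ℕ) : ℝ))⁻¹ *
          ((∏ i, (p i).1.factorial * (p i).2.factorial : ℕ) : ℝ)⁻¹) •
        nestedBracket
          (List.ofFn fun i => List.replicate (p i).1 x ++ List.replicate (p i).2 y).flatten

/-- A stratification `L = V₁ ⊕ ⋯ ⊕ Vₛ` of a real Lie algebra, with `[V₁, Vₖ] = Vₖ₊₁` for all
`k ≥ 1`, where `Vₖ = 0` for `k > s`. The index `0` is a dummy, with `V₀ = 0`. -/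
structure Stratification (L : Type*) [LieRing L] [LieAlgebra ℝ L] where
  /-- the number `s` of layers -/
  step : ℕ
  /-- the layers `Vₖ` -/
  layer : ℕ → Submodule ℝ L
  layer_zero : layer 0 = ⊥
  layer_of_step_lt : ∀ k, step < k → layer k = ⊥
  isInternal : DirectSum.IsInternal layer
  layer_succ : ∀ k, 1 ≤ k →
    layer (k + 1) = Submodule.span ℝ {z | ∃ x ∈ layer 1, ∃ y ∈ layer k, z = ⁅x, y⁆}

theorem Stratification.bijective_coeLinearMap {L : Type*} [LieRing L] [LieAlgebra ℝ L]
    (V : Stratification L) : Function.Bijective (DirectSum.coeLinearMap V.layer) :=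
  V.isInternal

/-- The linear map of a stratified Lie algebra that is multiplication by `r ^ k` on `Vₖ`. -/
def Stratification.dilation {L : Type*} [LieRing L] [LieAlgebra ℝ L] (V : Stratification L)
    (r : ℝ) : L →ₗ[ℝ] L :=
  (DirectSum.toModule ℝ ℕ L fun k => (r ^ k) • (V.layer k).subtype) ∘ₗ
    (LinearEquiv.ofBijective (DirectSum.coeLinearMap V.layer)
      V.bijective_coeLinearMap).symm.toLinearMap

theorem Stratification.dilation_of_mem {L : Type*} [LieRing L] [LieAlgebra ℝ L]
    (V : Stratification L) (r : ℝ) (k : ℕ) (v : L) (hv : v ∈ V.layer k) :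
    V.dilation r v = r ^ k • v := by
  have h : (LinearEquiv.ofBijective (DirectSum.coeLinearMap V.layer)
      V.bijective_coeLinearMap).symm v = DirectSum.lof ℝ ℕ (fun k => V.layer k) k ⟨v, hv⟩ := by
    rw [LinearEquiv.symm_apply_eq]
    simp
  simp [Stratification.dilation, h]

/-! ### Scalable groups -/

/-- The dilation structure of a scalable group: a continuous map `δ : ℝ × G → G` such that `δ_r` is
an automorphism of `G` for `r ≠ 0`, `δ_r ∘ δ_s = δ_{rs}`, and `δ_0` is constantly the identity
element. (For `r ≠ 0` the inverse of `δ_r` is `δ_{1/r}`, so `δ_r` is an automorphism of topological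
groups.) -/
structure ScalableStructure (G : Type*) [Group G] [TopologicalSpace G] where
  /-- the dilations -/
  dil : ℝ → G →* G
  continuous_dil : Continuous fun p : ℝ × G => dil p.1 p.2
  bijective_dil : ∀ r : ℝ, r ≠ 0 → Function.Bijective (dil r)
  dil_dil : ∀ (r s : ℝ) (g : G), dil r (dil s g) = dil (r * s) g
  dil_zero : ∀ g : G, dil 0 g = 1

namespace ScalableStructure

/-- A scalable subgroup: a closed subgroup `H` with `δ_r(H) = H` for all `r ≠ 0`. -/
def IsScalableSubgroup {G : Type*} [Group G] [TopologicalSpace G] (S : ScalableStructure G)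
    (H : Subgroup G) : Prop :=
  IsClosed (H : Set G) ∧ ∀ r : ℝ, r ≠ 0 → H.map (S.dil r) = H

/-- A Carnot subgroup: a scalable subgroup `H` that, with the restricted dilations, has a Carnot
group structure. Up to isomorphism, the simply connected Lie group with a given finite-dimensional
stratified (hence nilpotent) Lie algebra `L` is the vector space `L` with the
Baker-Campbell-Dynkin-Hausdorff product, and in these (exponential) coordinates its dilations are
the linear maps that multiply by `r ^ k` on `Vₖ`. So a Carnot group structure is a homeomorphism
`e : L → H` that carries this product to the product of `H` and these dilations to the dilations
of `H`. The topology on `L` is the unique Hausdorff vector space topology. -/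
def IsCarnotSubgroup {G : Type*} [Group G] [TopologicalSpace G] (S : ScalableStructure G)
    (H : Subgroup G) : Prop :=
  S.IsScalableSubgroup H ∧
    ∃ (L : Type) (_ : LieRing L) (_ : LieAlgebra ℝ L) (_ : FiniteDimensional ℝ L)
      (_ : TopologicalSpace L) (_ : IsTopologicalAddGroup L) (_ : ContinuousSMul ℝ L)
      (_ : T2Space L) (V : Stratification L) (e : L ≃ₜ H),
      (∀ x y : L, e (bch V.step x y) = e x * e y) ∧
      ∀ (r : ℝ) (x : L), (e (V.dilation r x) : G) = S.dil r (e x)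

/-- A filtration by Carnot subgroups: an increasing sequence of Carnot subgroups with dense
union. -/
def IsCarnotFiltration {G : Type*} [Group G] [TopologicalSpace G] (S : ScalableStructure G)
    (N : ℕ → Subgroup G) : Prop :=
  (∀ m, S.IsCarnotSubgroup (N m)) ∧ (∀ m, N m ≤ N (m + 1)) ∧ closure (⋃ m, (N m : Set G)) = Set.univ

/-- An infinite-dimensional Carnot group: a complete metric scalable group (the distance is left
invariant and homogeneous with respect to the dilations) that admits a filtration by Carnot
subgroups. -/
structure IsInfDimCarnotGroup {G : Type*} [Group G] [MetricSpace G] (S : ScalableStructure G) :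
    Prop where
  complete : CompleteSpace G
  dist_mul_left : ∀ g p q : G, dist (g * p) (g * q) = dist p q
  dist_dil : ∀ (t : ℝ) (p q : G), dist (S.dil t p) (S.dil t q) = |t| * dist p q
  exists_filtration : ∃ N : ℕ → Subgroup G, S.IsCarnotFiltration N

/-- The first layer `V₁(G)`: the elements `p` such that `t ↦ δ_t(p)` is a one-parameter subgroup
(continuity in `t` holds for every `p`). -/
def firstLayer {G : Type*} [Group G] [TopologicalSpace G] (S : ScalableStructure G) : Set G :=
  {p | ∀ s t : ℝ, S.dil (s + t) p = S.dil s p * S.dil t p}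

/-- The scalable subgroup generated by `A`: the closure of the group generated by all `δ_t(a)` with
`a ∈ A` and `t ∈ ℝ`. -/
def generated {G : Type*} [Group G] [TopologicalSpace G] [IsTopologicalGroup G]
    (S : ScalableStructure G) (A : Set G) : Subgroup G :=
  (Subgroup.closure {g | ∃ a ∈ A, ∃ t : ℝ, g = S.dil t a}).topologicalClosure

/-- The sequence of subgroups associated with a sequence `X`: the `i`-th one is generated by
`X 0, …, X i`. -/
def assocFiltration {G : Type*} [Group G] [TopologicalSpace G] [IsTopologicalGroup G]
    (S : ScalableStructure G) (X : ℕ → G) (i : ℕ) : Subgroup G :=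
  S.generated {g | ∃ j ≤ i, g = X j}

/-- A Carnot-spanning set: a sequence in the first layer whose associated subgroups form a
filtration by Carnot subgroups. -/
def IsCarnotSpanning {G : Type*} [Group G] [TopologicalSpace G] [IsTopologicalGroup G]
    (S : ScalableStructure G) (X : ℕ → G) : Prop :=
  (∀ i, X i ∈ S.firstLayer) ∧ S.IsCarnotFiltration (S.assocFiltration X)

/-! ### Aronszajn null sets -/

/-- The class `𝒜(Y)` of Borel sets that meet every left translate of the one-parameter subgroup
`t ↦ δ_t(Y)` in a set of times of Lebesgue measure zero. -/
def AronszajnClass {G : Type*} [Group G] [TopologicalSpace G] [MeasurableSpace G]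
    (S : ScalableStructure G) (Y : G) : Set (Set G) :=
  {E | MeasurableSet E ∧ ∀ g : G, volume {t : ℝ | g * S.dil t Y ∈ E} = 0}

/-- A set is Aronszajn null if, for every Carnot-spanning set `X`, it is a union of Borel sets
`F i` with `F i ∈ 𝒜(X i)`. -/
def AronszajnNull {G : Type*} [Group G] [TopologicalSpace G] [IsTopologicalGroup G]
    [MeasurableSpace G] (S : ScalableStructure G) (E : Set G) : Prop :=
  ∀ X : ℕ → G, S.IsCarnotSpanning X →
    ∃ F : ℕ → Set G, E = ⋃ i, F i ∧ ∀ i, F i ∈ S.AronszajnClass (X i)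

end ScalableStructure

/-! ### Convolutions of absolutely continuous measures -/

/-- `AC(H)`: the probability measures on `H` that are absolutely continuous with respect to Haar
measure, viewed as measures on `G`. -/
def ACMeasures {G : Type*} [Group G] [TopologicalSpace G] [MeasurableSpace G]
    (H : Subgroup G) : Set (Measure G) :=
  {μ | ∃ vol ν : Measure H, vol.IsHaarMeasure ∧ IsProbabilityMeasure ν ∧ ν ≪ vol ∧
    μ = ν.map (fun h : H => (h : G))}

/-- `convProd ν m n` is the convolution `ν (m + n) ∗ ⋯ ∗ ν (m + 1) ∗ ν m`. -/
def convProd {G : Type*} [Group G] [MeasurableSpace G] (ν : ℕ → Measure G) (m : ℕ) :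
    ℕ → Measure G
  | 0 => ν m
  | n + 1 => (ν (m + (n + 1))).mconv (convProd ν m n)

/-- The measures `c n` are probability measures and converge weakly to `μ`. -/
def TendstoWeakly {G : Type*} [TopologicalSpace G] [MeasurableSpace G] [OpensMeasurableSpace G]
    (c : ℕ → Measure G) (μ : ProbabilityMeasure G) : Prop :=
  ∃ p : ℕ → ProbabilityMeasure G, (∀ n, (p n : Measure G) = c n) ∧ Tendsto p atTop (𝓝 μ)

namespace ScalableStructure

/-- `CAC'(X)`: the weak limits of `ν k ∗ ⋯ ∗ ν 0`, where each `ν k` is an absolutely continuous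
probability measure on the `k`-th subgroup associated with `X`, and where for every `m` the
sequence `ν k ∗ ⋯ ∗ ν m` converges weakly too. -/
def CAC' {G : Type*} [Group G] [TopologicalSpace G] [IsTopologicalGroup G] [MeasurableSpace G]
    [OpensMeasurableSpace G] (S : ScalableStructure G) (X : ℕ → G) :
    Set (ProbabilityMeasure G) :=
  {μ | ∃ ν : ℕ → Measure G, (∀ k, ν k ∈ ACMeasures (S.assocFiltration X k)) ∧
    (∀ m, ∃ η : ProbabilityMeasure G, TendstoWeakly (convProd ν m) η) ∧
    TendstoWeakly (convProd ν 0) μ}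

/-- `CAC(X)`: the left translates of the measures in `CAC'(X)`. -/
def CAC {G : Type*} [Group G] [TopologicalSpace G] [IsTopologicalGroup G] [MeasurableSpace G]
    [OpensMeasurableSpace G] (S : ScalableStructure G) (X : ℕ → G) : Set (Measure G) :=
  {ν | ∃ g : G, ∃ μ ∈ S.CAC' X, ν = (μ : Measure G).map (fun x => g * x)}

/-- A set is CAC null if it is null for all measures in `CAC(X)`, for every Carnot-spanning
set `X`. -/
def CACNull {G : Type*} [Group G] [TopologicalSpace G] [IsTopologicalGroup G] [MeasurableSpace G]
    [OpensMeasurableSpace G] (S : ScalableStructure G) (E : Set G) : Prop :=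
  ∀ X : ℕ → G, S.IsCarnotSpanning X → ∀ μ ∈ S.CAC X, μ E = 0

end ScalableStructure

end

/-! The equivalence holds for each fixed Carnot-spanning sequence `X`: a Borel set is a union of
Borel sets `F i ∈ 𝒜(X i)` exactly when every measure in `CAC(X)` vanishes on it.

Unions are null (`cac_eq_zero_of_isAronszajnUnion`). For fixed `i`, the limit measure factors as `η
* (ν_i * ... * ν_0)`, where `η` is the weak limit of `ν_k * ... * ν_{i+1}`. The second factor is
absolutely continuous on `H_i`, up to right convolution with a law carried by `H_i`. Fubini along
the cosets of the line of `X i`, which lies in `H_i`, makes every translate of `F i` Haar null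
there, so averaging against `η` gives zero.

Sets that are not unions are charged (`exists_cac_ne_zero`). Two ingredients come from the structure
of the group. First, `H_k` carries an absolutely continuous law that is a finite convolution of
uniform laws on segments in the directions `X_0, ..., X_k` (`exists_isLineConv_mem_acMeasures`):
conjugates of the generating lines have tangent vectors spanning the Lie algebra, so some product of
lines is a submersion at a point. Second, such convolutions satisfy a density theorem modulo unions
(`IsLineConv.hasDensity`): Lebesgue's theorem on lines handles one segment, and the property passes
to convolutions.

The measure is then built by recursion. At stage `k` there is a set of base points `B`, not a union,
every point `x` of which satisfies `ρ(x⁻¹A) > c_k` for the current convolution `ρ`. Convolving on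
the left with a strongly contracted law on `H_k` loses little mass outside a negligible part of `B`,
by density. This leaves room to shrink `A` and the diameter of `B` (`exists_next_measure`). Base
points converge to some `g`, and contraction makes the random products converge almost surely. The
sets removed from `A` come from covers adapted to a finer Polish topology in which `E` is clopen
(`MeasurableSet.exists_covers`). They force the limit into `E` whenever infinitely many
approximations meet their targets, an event of probability at least `1/2`. -/

noncomputable section

/-! ### Gradation and tail filtration of a stratified Lie algebra. -/

namespace Stratification

variable {L : Type*} [LieRing L] [LieAlgebra ℝ L] (V : Stratification L)

theorem layer_le_bracket {i : ℕ} (hi : 1 ≤ i) {x y : L} (hx : x ∈ V.layer 1)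
    (hy : y ∈ V.layer i) : ⁅x, y⁆ ∈ V.layer (i + 1) := by
  rw [V.layer_succ i hi]
  exact Submodule.subset_span ⟨x, hx, y, hy, rfl⟩

/-- The layers grade the Lie algebra. -/
theorem lie_mem_layer {i j : ℕ} (hi : 1 ≤ i) (hj : 1 ≤ j) {x y : L} (hx : x ∈ V.layer i)
    (hy : y ∈ V.layer j) : ⁅x, y⁆ ∈ V.layer (i + j) := by
  induction i, hi using Nat.le_induction generalizing j x y with
  | base => rw [add_comm]; exact V.layer_le_bracket hj hx hy
  | succ i hi ih =>
    rw [V.layer_succ i hi] at hx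
    induction hx using Submodule.span_induction with
    | mem z hz =>
      obtain ⟨a, ha, b, hb, rfl⟩ := hz
      -- Jacobi moves the degree-one factor `a` outward, so only brackets with `b`, of degree `i`,
      -- remain. This is why the induction must range over all `j`: it is used at `j` and at `j +
      -- 1`.
      rw [lie_lie]
      refine Submodule.sub_mem _ ?_ ?_
      · have := V.layer_le_bracket (by omega) ha (ih hj hb hy)
        rwa [show i + 1 + j = i + j + 1 by omega]
      · have := ih (by omega) hb (V.layer_le_bracket hj ha hy)
        rwa [show i + 1 + j = i + (j + 1) by omega]
    | zero => simp
    | add a b _ _ ha hb => rw [add_lie]; exact Submodule.add_mem _ ha hb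
    | smul c a _ ha => rw [smul_lie]; exact Submodule.smul_mem _ _ ha

/-- The sum of the layers of index at least `m`. -/
def tail (m : ℕ) : Submodule ℝ L := ⨆ k ≥ m, V.layer k

theorem layer_le_tail {m k : ℕ} (h : m ≤ k) : V.layer k ≤ V.tail m :=
  le_iSup₂_of_le k h le_rfl

theorem tail_anti {m n : ℕ} (h : m ≤ n) : V.tail n ≤ V.tail m :=
  iSup₂_le fun _ hk => V.layer_le_tail (h.trans hk)

theorem tail_eq_layer_sup (m : ℕ) : V.tail m = V.layer m ⊔ V.tail (m + 1) := by
  refine le_antisymm (iSup₂_le fun k hk => ?_)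
    (sup_le (V.layer_le_tail le_rfl) (V.tail_anti m.le_succ))
  rcases eq_or_lt_of_le (show m ≤ k from hk) with rfl | h
  · exact le_sup_left
  · exact le_sup_of_le_right (V.layer_le_tail h)

theorem tail_zero : V.tail 0 = ⊤ := by
  have := V.isInternal.submodule_iSup_eq_top
  rw [eq_top_iff, ← this]
  exact iSup_le fun k => V.layer_le_tail (Nat.zero_le k)

theorem tail_one : V.tail 1 = ⊤ := by
  rw [← V.tail_zero, V.tail_eq_layer_sup 0, V.layer_zero, bot_sup_eq]

theorem tail_of_step_lt {m : ℕ} (h : V.step < m) : V.tail m = ⊥ := by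
  refine eq_bot_iff.2 (iSup₂_le fun k hk => ?_)
  rw [V.layer_of_step_lt k (lt_of_lt_of_le h hk)]

theorem disjoint_layer_tail (m : ℕ) : Disjoint (V.layer m) (V.tail (m + 1)) := by
  have := V.isInternal.submodule_iSupIndep m
  refine this.mono_right (iSup₂_le fun k hk => ?_)
  exact le_iSup₂_of_le k (by have : m + 1 ≤ k := hk; omega) le_rfl

theorem lie_mem_tail {i j : ℕ} (hi : 1 ≤ i) (hj : 1 ≤ j) {x y : L} (hx : x ∈ V.tail i)
    (hy : y ∈ V.tail j) : ⁅x, y⁆ ∈ V.tail (i + j) := by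
  have key : ∀ k ≥ i, ∀ x ∈ V.layer k, ∀ y ∈ V.tail j, ⁅x, y⁆ ∈ V.tail (i + j) := by
    intro k hk x hx y hy
    have : V.tail j ≤ (V.tail (i + j)).comap (LieModule.toEnd ℝ L L x) := by
      refine iSup₂_le fun l hl y hy => ?_
      have hk' : i ≤ k := hk
      have hl' : j ≤ l := hl
      exact V.layer_le_tail (by omega) (V.lie_mem_layer (by omega) (by omega) hx hy)
    exact this hy
  have : V.tail i ≤ (V.tail (i + j)).comap (LieModule.toEnd ℝ L L y) :=
    iSup₂_le fun k hk x hx => by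
      have := key k hk x hx y hy
      rwa [← lie_skew, neg_mem_iff] at this
  rw [← lie_skew, neg_mem_iff]
  exact this hx

end Stratification

/-! ### Low-order terms of the Baker-Campbell-Dynkin-Hausdorff product. -/

section NestedBracket

variable {L : Type*} [LieRing L]

theorem nestedBracket_cons (a : L) {l : List L} (h : l ≠ []) :
    nestedBracket (a :: l) = ⁅a, nestedBracket l⁆ := by
  cases l with
  | nil => exact absurd rfl h
  | cons b l => rfl

theorem nestedBracket_eq_zero_of_forall_eq {x : L} :
    ∀ {l : List L}, 2 ≤ l.length → (∀ a ∈ l, a = x) → nestedBracket l = 0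
  | [a, b], _, h => by
    have ha : a = x := h a (by simp)
    have hb : b = x := h b (by simp)
    simp [nestedBracket, ha, hb]
  | a :: b :: c :: l, _, h => by
    rw [nestedBracket_cons a (by simp), nestedBracket_eq_zero_of_forall_eq (x := x) (l := b :: c :: l)
      (by simp) (fun d hd => h d (by simp [hd])), lie_zero]

/-- A nested bracket of a word in `x ∈ tail i` and `y ∈ tail j` in which both letters occur, of
length at least three. -/
theorem nestedBracket_mem_tail_of_mem [LieAlgebra ℝ L] (V : Stratification L) {i j : ℕ}
    (hi : 1 ≤ i) (hj : 1 ≤ j) {x y : L} (hx : x ∈ V.tail i) (hy : y ∈ V.tail j) :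
    ∀ {l : List L}, (∀ a ∈ l, a = x ∨ a = y) →
      (2 ≤ l.length → nestedBracket l ∈ V.tail (i + j)) ∧
      (3 ≤ l.length → nestedBracket l ∈ V.tail (i + j + 1)) := by
  intro l
  induction l with
  | nil => simp
  | cons a l ih =>
    intro h
    have ih := ih fun b hb => h b (by simp [hb])
    have ha : a ∈ V.tail 1 := by simp [V.tail_one]
    refine ⟨fun hl => ?_, fun hl => ?_⟩
    · match l, hl with
      | [b], _ =>
        have ha := h a (by simp)
        have hb := h b (by simp)
        simp only [nestedBracket]
        rcases ha with rfl | rfl <;> rcases hb with rfl | rfl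
        · simp
        · exact V.lie_mem_tail hi hj hx hy
        · rw [add_comm]; exact V.lie_mem_tail hj hi hy hx
        · simp
      | b :: c :: l, _ =>
        rw [nestedBracket_cons a (by simp)]
        exact V.tail_anti (by omega) (V.lie_mem_tail le_rfl (by omega) ha (ih.1 (by simp)))
    · rw [nestedBracket_cons a (by rintro rfl; simp at hl)]
      exact V.tail_anti (by omega)
        (V.lie_mem_tail le_rfl (by omega) ha (ih.1 (by simp at hl; omega)))

end NestedBracket

section BCH

variable {L : Type*} [LieRing L] [LieAlgebra ℝ L]

/-- The word `x ^ r₁ y ^ s₁ ⋯ x ^ rₖ y ^ sₖ`. -/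
def dynkinWord {α : Type*} (x y : α) {k : ℕ} (p : Fin k → ℕ × ℕ) : List α :=
  (List.ofFn fun i => List.replicate (p i).1 x ++ List.replicate (p i).2 y).flatten

theorem eq_or_eq_of_mem_dynkinWord {α : Type*} {x y : α} {k : ℕ} {p : Fin k → ℕ × ℕ} {a : α}
    (h : a ∈ dynkinWord x y p) : a = x ∨ a = y := by
  simp only [dynkinWord, List.mem_flatten, List.mem_ofFn] at h
  obtain ⟨l, ⟨i, rfl⟩, h⟩ := h
  rw [List.mem_append, List.mem_replicate, List.mem_replicate] at h
  tauto

theorem length_dynkinWord {α : Type*} (x y : α) {k : ℕ} (p : Fin k → ℕ × ℕ) :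
    (dynkinWord x y p).length = ∑ i, ((p i).1 + (p i).2) := by
  simp [dynkinWord, List.length_flatten, List.map_ofFn, List.sum_ofFn, Function.comp_def]

theorem map_dynkinWord {α β : Type*} (f : α → β) (x y : α) {k : ℕ} (p : Fin k → ℕ × ℕ) :
    (dynkinWord x y p).map f = dynkinWord (f x) (f y) p := by
  simp [dynkinWord, List.map_flatten, List.map_ofFn, Function.comp_def]

/-- The exponents that occur in Dynkin's formula. -/
def dynkinIndex (N k : ℕ) : Finset (Fin k → ℕ × ℕ) :=
  Fintype.piFinset (fun _ : Fin k =>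
    (Finset.range (N + 1) ×ˢ Finset.range (N + 1)).filter (fun q : ℕ × ℕ => q ≠ (0, 0)))

/-- The coefficients in Dynkin's formula. -/
def dynkinCoeff {k : ℕ} (p : Fin k → ℕ × ℕ) : ℝ :=
  (((∑ i, ((p i).1 + (p i).2) : ℕ) : ℝ))⁻¹ *
    ((∏ i, (p i).1.factorial * (p i).2.factorial : ℕ) : ℝ)⁻¹

theorem bch_def (N : ℕ) (x y : L) :
    bch N x y = ∑ k ∈ Finset.Icc 1 N, ((-1 : ℝ) ^ (k - 1) / (k : ℝ)) •
      ∑ p ∈ dynkinIndex N k, dynkinCoeff p • nestedBracket (dynkinWord x y p) := rfl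

theorem mem_dynkinIndex {N k : ℕ} {p : Fin k → ℕ × ℕ} :
    p ∈ dynkinIndex N k ↔ ∀ i, (p i).1 ≤ N ∧ (p i).2 ≤ N ∧ 1 ≤ (p i).1 + (p i).2 := by
  simp only [dynkinIndex, Fintype.mem_piFinset, Finset.mem_filter, Finset.mem_product,
    Finset.mem_range, ne_eq, Prod.ext_iff]
  refine forall_congr' fun i => ?_
  omega

/-- The terms of order at most two of the Baker-Campbell-Dynkin-Hausdorff product. -/
theorem bch_sub_mem {N : ℕ} (hN : 1 ≤ N) (x y : L) (M : Submodule ℝ L)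
    (hM : ∀ l : List L, 3 ≤ l.length → (∀ a ∈ l, a = x ∨ a = y) → nestedBracket l ∈ M) :
    bch N x y - (x + y + (1 / 2 : ℝ) • ⁅x, y⁆) ∈ M := by
  have hword : ∀ {k : ℕ} (p : Fin k → ℕ × ℕ), 3 ≤ ∑ i, ((p i).1 + (p i).2) →
      nestedBracket (dynkinWord x y p) ∈ M := fun p hp =>
    hM _ (by rwa [length_dynkinWord]) fun a ha => eq_or_eq_of_mem_dynkinWord ha
  -- Each of the `k` blocks is nonempty, so words with at least three blocks have length at least
  -- three.
  have h3 : ∀ k, 3 ≤ k →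
      ∑ p ∈ dynkinIndex N k, dynkinCoeff p • nestedBracket (dynkinWord x y p) ∈ M := by
    refine fun k hk => Submodule.sum_mem _ fun p hp => Submodule.smul_mem _ _ (hword p ?_)
    calc 3 ≤ k := hk
      _ = ∑ _i : Fin k, 1 := by simp
      _ ≤ _ := Finset.sum_le_sum fun i _ => ((mem_dynkinIndex.1 hp) i).2.2
  -- With two blocks the only short words with nonzero bracket are `xy` and `yx`; they have equal
  -- coefficients and cancel.
  have h2 : ∑ p ∈ dynkinIndex N 2, dynkinCoeff p • nestedBracket (dynkinWord x y p) ∈ M := by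
    let T : Finset (Fin 2 → ℕ × ℕ) := {![(1, 0), (0, 1)], ![(0, 1), (1, 0)]}
    have hT : T ⊆ dynkinIndex N 2 := by
      intro p hp
      simp only [T, Finset.mem_insert, Finset.mem_singleton] at hp
      rw [mem_dynkinIndex, Fin.forall_fin_two]
      rcases hp with rfl | rfl <;> simp [hN]
    rw [← Finset.sum_sdiff hT]
    refine Submodule.add_mem _ (Submodule.sum_mem _ fun p hp => Submodule.smul_mem _ _ ?_) ?_
    · rw [Finset.mem_sdiff, mem_dynkinIndex, Fin.forall_fin_two] at hp
      obtain ⟨⟨⟨-, -, h0⟩, -, -, h1⟩, hp⟩ := hp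
      by_cases hs : 3 ≤ ∑ i, ((p i).1 + (p i).2)
      · exact hword p hs
      · rw [Fin.sum_univ_two] at hs
        have hpT : ∀ a b : ℕ × ℕ, p 0 = a → p 1 = b → ![a, b] ∉ T := by
          rintro a b rfl rfl h
          apply hp
          convert h
          ext i <;> fin_cases i <;> rfl
        rcases h0' : p 0 with ⟨a, b⟩
        rcases h1' : p 1 with ⟨c, d⟩
        have := hpT _ _ h0' h1'
        simp only [h0', h1'] at h0 h1 hs
        have hw : dynkinWord x y p = List.replicate a x ++ List.replicate b y ++
            (List.replicate c x ++ List.replicate d y) := by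
          simp [dynkinWord, List.ofFn_succ, h0', h1']
        rw [hw]
        have hab : (a = 1 ∧ b = 0) ∨ (a = 0 ∧ b = 1) := by omega
        have hcd : (c = 1 ∧ d = 0) ∨ (c = 0 ∧ d = 1) := by omega
        rcases hab with ⟨rfl, rfl⟩ | ⟨rfl, rfl⟩ <;> rcases hcd with ⟨rfl, rfl⟩ | ⟨rfl, rfl⟩
        · simp [nestedBracket]
        · exact absurd (by simp [T]) this
        · exact absurd (by simp [T]) this
        · simp [nestedBracket]
    · rw [Finset.sum_pair (by decide)]
      have h0 : (dynkinCoeff ![(1, 0), (0, 1)] : ℝ) • nestedBracket (dynkinWord x y ![(1, 0), (0, 1)])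
          + dynkinCoeff ![(0, 1), (1, 0)] • nestedBracket (dynkinWord x y ![(0, 1), (1, 0)]) = 0 := by
        simp [dynkinCoeff, dynkinWord, List.ofFn_succ, nestedBracket, -smul_add, ← smul_add]
        rw [← lie_skew x y, neg_add_cancel]
      rw [h0]
      exact Submodule.zero_mem _
  -- The words `x`, `y` and `xy` of a single block produce the whole second-order expansion; `xx`
  -- and `yy` have zero bracket.
  have h1 : ∑ p ∈ dynkinIndex N 1, dynkinCoeff p • nestedBracket (dynkinWord x y p)
      - (x + y + (1 / 2 : ℝ) • ⁅x, y⁆) ∈ M := by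
    let T : Finset (Fin 1 → ℕ × ℕ) := {![(1, 0)], ![(0, 1)], ![(1, 1)]}
    have hT : T ⊆ dynkinIndex N 1 := by
      intro p hp
      simp only [T, Finset.mem_insert, Finset.mem_singleton] at hp
      rw [mem_dynkinIndex, Fin.forall_fin_one]
      rcases hp with rfl | rfl | rfl <;> simp [hN]
    have hsum : ∑ p ∈ T, dynkinCoeff p • nestedBracket (dynkinWord x y p)
        = x + y + (1 / 2 : ℝ) • ⁅x, y⁆ := by
      rw [Finset.sum_insert (by decide), Finset.sum_pair (by decide), ← add_assoc]
      simp [dynkinCoeff, dynkinWord, List.ofFn_succ, nestedBracket]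
    rw [← Finset.sum_sdiff hT, hsum, add_sub_cancel_right]
    refine Submodule.sum_mem _ fun p hp => Submodule.smul_mem _ _ ?_
    rw [Finset.mem_sdiff, mem_dynkinIndex, Fin.forall_fin_one] at hp
    obtain ⟨⟨-, -, h0⟩, hp⟩ := hp
    by_cases hs : 3 ≤ ∑ i, ((p i).1 + (p i).2)
    · exact hword p hs
    · rw [Fin.sum_univ_one] at hs
      have hpT : ∀ a : ℕ × ℕ, p 0 = a → ![a] ∉ T := by
        rintro a rfl h
        apply hp
        convert h
        ext i <;> fin_cases i <;> rfl
      rcases h0' : p 0 with ⟨a, b⟩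
      have := hpT _ h0'
      simp only [h0'] at h0 hs
      have hw : dynkinWord x y p = List.replicate a x ++ List.replicate b y := by
        simp [dynkinWord, List.ofFn_succ, h0']
      rw [hw]
      have hab : (a = 1 ∧ b = 0) ∨ (a = 0 ∧ b = 1) ∨ (a = 1 ∧ b = 1) ∨ (a = 2 ∧ b = 0) ∨
        (a = 0 ∧ b = 2) := by omega
      rcases hab with ⟨rfl, rfl⟩ | ⟨rfl, rfl⟩ | ⟨rfl, rfl⟩ | ⟨rfl, rfl⟩ | ⟨rfl, rfl⟩
      · exact absurd (by simp [T]) this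
      · exact absurd (by simp [T]) this
      · exact absurd (by simp [T]) this
      · simp [nestedBracket, List.replicate]
      · simp [nestedBracket, List.replicate]
  rw [bch_def, ← Finset.add_sum_erase _ _ (Finset.mem_Icc.2 ⟨le_rfl, hN⟩), add_sub_right_comm]
  refine Submodule.add_mem _ (by simpa using h1) (Submodule.sum_mem _ fun k hk =>
    Submodule.smul_mem _ _ ?_)
  rw [Finset.mem_erase, Finset.mem_Icc] at hk
  rcases eq_or_ne k 2 with rfl | hk2
  · exact h2
  · exact h3 k (by omega)

theorem Stratification.subsingleton_of_step_eq_zero (V : Stratification L) (h : V.step = 0) :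
    Subsingleton L := by
  have h1 := V.tail_of_step_lt (m := 1) (by omega)
  rw [V.tail_one] at h1
  exact (Submodule.subsingleton_iff ℝ).1 (subsingleton_of_bot_eq_top h1.symm)

theorem Stratification.bch_sub_mem_tail (V : Stratification L) {i j : ℕ} (hi : 1 ≤ i) (hj : 1 ≤ j)
    {x y : L} (hx : x ∈ V.tail i) (hy : y ∈ V.tail j) :
    bch V.step x y - (x + y + (1 / 2 : ℝ) • ⁅x, y⁆) ∈ V.tail (i + j + 1) := by
  rcases Nat.eq_zero_or_pos V.step with h | h
  · have := V.subsingleton_of_step_eq_zero h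
    convert Submodule.zero_mem _
  · exact bch_sub_mem h x y _ fun l hl hxy => (nestedBracket_mem_tail_of_mem V hi hj hx hy hxy).2 hl

theorem Stratification.bch_sub_add_mem_tail (V : Stratification L) {i j : ℕ} (hi : 1 ≤ i)
    (hj : 1 ≤ j) {x y : L} (hx : x ∈ V.tail i) (hy : y ∈ V.tail j) :
    bch V.step x y - (x + y) ∈ V.tail (i + j) := by
  have h := V.tail_anti (Nat.le_succ _) (V.bch_sub_mem_tail hi hj hx hy)
  have h' := Submodule.smul_mem _ (1 / 2 : ℝ) (V.lie_mem_tail hi hj hx hy)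
  have := Submodule.add_mem _ h h'
  convert this using 1
  abel

theorem Stratification.bch_self (V : Stratification L) (x : L) :
    bch V.step x x = (2 : ℝ) • x := by
  rcases Nat.eq_zero_or_pos V.step with h | h
  · have := V.subsingleton_of_step_eq_zero h
    exact Subsingleton.elim _ _
  · have := bch_sub_mem h x x ⊥ fun l hl hxy => by
      rw [nestedBracket_eq_zero_of_forall_eq (x := x) (by omega) fun a ha => by simpa using hxy a ha]
      exact Submodule.zero_mem _
    rw [Submodule.mem_bot, sub_eq_zero] at this
    rw [this, lie_self, smul_zero, add_zero, two_smul]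

theorem Stratification.dilation_mem_tail (V : Stratification L) (r : ℝ) {m : ℕ} {x : L}
    (hx : x ∈ V.tail m) : V.dilation r x ∈ V.tail m := by
  have : V.tail m ≤ (V.tail m).comap (V.dilation r) := iSup₂_le fun k hk y hy => by
    rw [Submodule.mem_comap, V.dilation_of_mem r k y hy]
    exact Submodule.smul_mem _ _ (V.layer_le_tail hk hy)
  exact this hx

/-- An element whose dilation by `2` is its double lies in the first layer. -/
theorem Stratification.mem_layer_one_of_dilation_two (V : Stratification L) {x : L}
    (h : V.dilation 2 x = (2 : ℝ) • x) : x ∈ V.layer 1 := by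
  have hx : x ∈ V.tail 1 := by simp [V.tail_one]
  rw [V.tail_eq_layer_sup, Submodule.mem_sup] at hx
  obtain ⟨a, ha, z, hz, rfl⟩ := hx
  have hz2 : V.dilation 2 z = (2 : ℝ) • z := by
    rw [map_add, V.dilation_of_mem 2 1 a ha, pow_one, smul_add] at h
    exact add_left_cancel h
  -- The dilation is `2 ^ m ≠ 2` on layer `m ≥ 2`, so the degree-`m` component of `z` vanishes and
  -- `z` drops into the next tail; past the last layer nothing is left.
  have hmem : ∀ m ≥ 2, z ∈ V.tail m := by
    intro m hm
    induction m, hm using Nat.le_induction with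
    | base => exact hz
    | succ m hm ih =>
      rw [V.tail_eq_layer_sup, Submodule.mem_sup] at ih
      obtain ⟨b, hb, w, hw, rfl⟩ := ih
      rw [map_add, V.dilation_of_mem 2 m b hb, smul_add] at hz2
      have h1 : ((2 : ℝ) ^ m - 2) • b = (2 : ℝ) • w - V.dilation 2 w := by
        rw [sub_smul, sub_eq_sub_iff_add_eq_add, hz2, add_comm]
      have h2 : ((2 : ℝ) ^ m - 2) • b ∈ V.tail (m + 1) := by
        rw [h1]
        exact Submodule.sub_mem _ (Submodule.smul_mem _ _ hw) (V.dilation_mem_tail 2 hw)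
      have h3 : (2 : ℝ) ^ m - 2 ≠ 0 := by
        have : (2 : ℝ) ^ 2 ≤ 2 ^ m := pow_le_pow_right₀ (by norm_num) hm
        linarith
      have h4 : b ∈ V.tail (m + 1) := (Submodule.smul_mem_iff _ h3).1 h2
      exact Submodule.add_mem _ h4 hw
  have h0 := hmem (V.step + 2) (by omega)
  rw [V.tail_of_step_lt (by omega), Submodule.mem_bot] at h0
  rwa [h0, add_zero]

end BCH

/-! ### Leading terms of group commutators and conjugates. -/

namespace Stratification

variable {L : Type*} [LieRing L] [LieAlgebra ℝ L] (V : Stratification L)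
  {H : Type*} [Group H] (e : L ≃ H)

theorem symm_mul (he : ∀ x y : L, e (bch V.step x y) = e x * e y) (a b : H) :
    e.symm (a * b) = bch V.step (e.symm a) (e.symm b) := by
  rw [Equiv.symm_apply_eq, he, e.apply_symm_apply, e.apply_symm_apply]

theorem exp_zero (he : ∀ x y : L, e (bch V.step x y) = e x * e y) : e 0 = 1 := by
  have := he 0 0
  rw [V.bch_self, smul_zero] at this
  exact left_eq_mul.1 this

/-- The leading term of a group commutator is the Lie bracket. -/
theorem symm_commutator (he : ∀ x y : L, e (bch V.step x y) = e x * e y) {i j : ℕ} (hi : 1 ≤ i)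
    (hj : 1 ≤ j) {a b : H} (ha : e.symm a ∈ V.tail i) (hb : e.symm b ∈ V.tail j) :
    e.symm (a * b * a⁻¹ * b⁻¹) ∈ V.tail (i + j) ∧
      e.symm (a * b * a⁻¹ * b⁻¹) - ⁅e.symm a, e.symm b⁆ ∈ V.tail (i + j + 1) := by
  set c := a * b * a⁻¹ * b⁻¹ with hc
  set x := e.symm a with hx
  set y := e.symm b with hy
  -- The commutator is read off by comparing `log (ab)` with `log (ba)`: their difference is `⁅x,
  -- y⁆` up to higher order, and it is also `log c` up to higher order than `c`.
  have hab : a * b = c * (b * a) := by rw [hc]; group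
  have hdiff : e.symm (a * b) - e.symm (b * a) - ⁅x, y⁆ ∈ V.tail (i + j + 1) := by
    have h1 := V.bch_sub_mem_tail hi hj ha hb
    have h2 := V.bch_sub_mem_tail hj hi hb ha
    rw [← V.symm_mul e he] at h1 h2
    rw [add_comm j i] at h2
    have h3 := Submodule.sub_mem _ h1 h2
    rw [← lie_skew x y] at h3
    convert h3 using 1
    rw [← lie_skew x y]
    module
  have hxy : ⁅x, y⁆ ∈ V.tail (i + j) := V.lie_mem_tail hi hj ha hb
  have hdiff' : e.symm (a * b) - e.symm (b * a) ∈ V.tail (i + j) := by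
    have := Submodule.add_mem _ (V.tail_anti (Nat.le_succ _) hdiff) hxy
    rwa [sub_add_cancel] at this
  have hstep : ∀ m ≥ 1, e.symm c ∈ V.tail m →
      e.symm (a * b) - e.symm (b * a) - e.symm c ∈ V.tail (m + 1) := by
    intro m hm hcm
    have := V.bch_sub_add_mem_tail hm le_rfl hcm (y := e.symm (b * a)) (by simp [V.tail_one])
    rw [← V.symm_mul e he, ← hab] at this
    convert this using 1
    abel
  -- Bootstrap: nothing is known about the order of `c` at first, and each comparison raises it by
  -- one until it reaches `i + j`.
  have hmem : ∀ m ≥ 1, m ≤ i + j → e.symm c ∈ V.tail m := by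
    intro m hm
    induction m, hm using Nat.le_induction with
    | base => simp [V.tail_one]
    | succ m hm ih =>
      intro hle
      have := Submodule.sub_mem _ (V.tail_anti hle hdiff') (hstep m hm (ih (by omega)))
      rwa [sub_sub_cancel] at this
  have hcm := hmem (i + j) (by omega) le_rfl
  refine ⟨hcm, ?_⟩
  have := Submodule.sub_mem _ hdiff (hstep (i + j) (by omega) hcm)
  convert this using 1
  abel

/-- The conjugate is the commutator times `b`. Multiplying by `b` only adds brackets of order one
more than the commutator, which already has order `i + 1`. -/
theorem symm_conj (he : ∀ x y : L, e (bch V.step x y) = e x * e y) {i : ℕ} (hi : 1 ≤ i)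
    {a : H} (ha : e.symm a ∈ V.tail i) (b : H) :
    e.symm (a * b * a⁻¹) - (e.symm b + ⁅e.symm a, e.symm b⁆) ∈ V.tail (i + 2) := by
  have hb : e.symm b ∈ V.tail 1 := by simp [V.tail_one]
  obtain ⟨h1, h2⟩ := V.symm_commutator e he hi le_rfl ha hb
  have h3 := V.bch_sub_add_mem_tail (by omega) le_rfl h1 hb
  rw [← V.symm_mul e he, show a * b * a⁻¹ * b⁻¹ * b = a * b * a⁻¹ by group] at h3
  have := Submodule.add_mem _ h3 h2
  convert this using 1
  abel

variable (Γ : Subgroup H) (A : Set L)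

/-- Every layer is spanned by leading terms of elements of the group generated by the first
layer. -/
theorem layer_eq_span_leading (he : ∀ x y : L, e (bch V.step x y) = e x * e y)
    (hA : V.layer 1 = Submodule.span ℝ A) (hΓ : ∀ x ∈ A, e x ∈ Γ) {k : ℕ} (hk : 1 ≤ k) :
    V.layer k ≤ Submodule.span ℝ
      {v | v ∈ V.layer k ∧ ∃ h ∈ Γ, e.symm h - v ∈ V.tail (k + 1)} := by
  induction k, hk using Nat.le_induction with
  | base =>
    rw [hA]
    refine Submodule.span_mono fun x hx => ⟨Submodule.subset_span hx, e x, hΓ x hx, ?_⟩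
    simp
  | succ k hk ih =>
    refine (V.layer_succ k hk).trans_le (Submodule.span_le.2 ?_)
    rintro _ ⟨x, hx, y, hy, rfl⟩
    replace hy := ih hy
    rw [hA] at hx
    -- If `h ∈ Γ` has leading term `v`, then the commutator of `e x` with `h` lies in `Γ` and has
    -- leading term `⁅x, v⁆`.
    have hbase : ∀ v ∈ {v | v ∈ V.layer k ∧ ∃ h ∈ Γ, e.symm h - v ∈ V.tail (k + 1)}, ∀ x ∈ A,
        ⁅x, v⁆ ∈ Submodule.span ℝ
          {v | v ∈ V.layer (k + 1) ∧ ∃ h ∈ Γ, e.symm h - v ∈ V.tail (k + 1 + 1)} := by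
      rintro v ⟨hv, h, hh, hhv⟩ x hx
      have hx1 : x ∈ V.layer 1 := hA ▸ Submodule.subset_span hx
      have hvt := V.layer_le_tail le_rfl hv
      have hht : e.symm h ∈ V.tail k := by
        have := Submodule.add_mem _ (V.tail_anti (Nat.le_succ _) hhv) hvt
        rwa [sub_add_cancel] at this
      have hc := (V.symm_commutator e he le_rfl hk (a := e x) (b := h)
        (by simp [V.tail_one]) hht).2
      refine Submodule.subset_span ⟨V.layer_le_bracket hk hx1 hv, e x * h * (e x)⁻¹ * h⁻¹,
        Γ.mul_mem (Γ.mul_mem (Γ.mul_mem (hΓ x hx) hh) (Γ.inv_mem (hΓ x hx))) (Γ.inv_mem hh), ?_⟩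
      have h2 := V.lie_mem_tail (x := x) le_rfl (by omega) (by simp [V.tail_one]) hhv
      rw [e.symm_apply_apply, add_comm 1 k] at hc
      rw [add_comm 1 (k + 1), lie_sub] at h2
      have := Submodule.add_mem _ hc h2
      convert this using 1
      abel
    simp only [SetLike.mem_coe]
    induction hy using Submodule.span_induction with
    | mem v hv =>
      induction hx using Submodule.span_induction with
      | mem x hx => exact hbase v hv x hx
      | zero => simp
      | add a b _ _ ha hb => rw [add_lie]; exact Submodule.add_mem _ ha hb
      | smul c a _ ha => rw [smul_lie]; exact Submodule.smul_mem _ _ ha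
    | zero => simp
    | add a b _ _ ha hb => rw [lie_add]; exact Submodule.add_mem _ ha hb
    | smul c a _ ha => rw [lie_smul]; exact Submodule.smul_mem _ _ ha

/-- A subspace that contains, up to terms of higher order, the conjugates of the generators of the
first layer is everything. -/
theorem eq_top_of_leading_conj (he : ∀ x y : L, e (bch V.step x y) = e x * e y)
    (hA : V.layer 1 = Submodule.span ℝ A) (hΓ : ∀ x ∈ A, e x ∈ Γ) (D : Submodule ℝ L)
    (hAD : A ⊆ D) (hD : ∀ h ∈ Γ, ∀ x ∈ A, ∀ i ≥ 1, e.symm h ∈ V.tail i →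
      ∃ d ∈ D, d - (x + ⁅e.symm h, x⁆) ∈ V.tail (i + 2)) : D = ⊤ := by
  -- `D` contains both `x` and a vector that agrees with `x + ⁅v, x⁆` to leading order, hence their
  -- difference. These brackets span layer `k` when `v` runs over leading terms of degree `k - 1`.
  have hlayer : ∀ k ≥ 1, V.layer k ≤ D ⊔ V.tail (k + 1) := by
    intro k hk
    rcases eq_or_lt_of_le (show 1 ≤ k from hk) with rfl | hk1
    · rw [hA]
      exact le_sup_of_le_left (Submodule.span_le.2 hAD)
    obtain ⟨j, rfl⟩ : ∃ j, k = j + 1 := ⟨k - 1, by omega⟩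
    have hj : 1 ≤ j := by omega
    rw [V.layer_succ j hj, Submodule.span_le]
    rintro _ ⟨x, hx, y, hy, rfl⟩
    rw [SetLike.mem_coe, ← lie_skew, neg_mem_iff]
    replace hy := V.layer_eq_span_leading e Γ A he hA hΓ hj hy
    rw [hA] at hx
    induction hx using Submodule.span_induction with
    | mem x hx =>
      induction hy using Submodule.span_induction with
      | mem v hv =>
        obtain ⟨hv, h, hh, hhv⟩ := hv
        have hht : e.symm h ∈ V.tail j := by
          have := Submodule.add_mem _ (V.tail_anti (Nat.le_succ _) hhv) (V.layer_le_tail le_rfl hv)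
          rwa [sub_add_cancel] at this
        obtain ⟨d, hd, hdx⟩ := hD h hh x hx j hj hht
        have h2 := V.lie_mem_tail (y := x) (by omega) le_rfl hhv (by simp [V.tail_one])
        rw [sub_lie] at h2
        have h3 := neg_mem (Submodule.add_mem _ hdx h2)
        refine Submodule.mem_sup.2 ⟨d - x, Submodule.sub_mem _ hd (hAD hx), _, h3, ?_⟩
        abel
      | zero => simp
      | add a b _ _ ha hb => rw [add_lie]; exact Submodule.add_mem _ ha hb
      | smul c a _ ha => rw [smul_lie]; exact Submodule.smul_mem _ _ ha
    | zero => simp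
    | add a b _ _ ha hb => rw [lie_add]; exact Submodule.add_mem _ ha hb
    | smul c a _ ha => rw [lie_smul]; exact Submodule.smul_mem _ _ ha
  have htail : ∀ m, D ⊔ V.tail (m + 1) = ⊤ := by
    intro m
    induction m with
    | zero => rw [zero_add, V.tail_one, sup_top_eq]
    | succ m ih =>
      rw [eq_top_iff, ← ih, V.tail_eq_layer_sup (m + 1)]
      exact sup_le le_sup_left (sup_le (hlayer _ (by omega)) le_sup_right)
  have := htail V.step
  rwa [V.tail_of_step_lt (Nat.lt_succ_self _), sup_bot_eq] at this

end Stratification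

/-! ### Products of one-parameter subgroups -/

namespace ScalableStructure

variable {G : Type*} [Group G] [TopologicalSpace G] (S : ScalableStructure G)

/-- The maps `t ↦ δ_{t₁}(Y₁) ⋯ δ_{tₙ}(Yₙ)` with `Yᵢ ∈ A`. -/
inductive IsPlot (A : Set G) : (n : ℕ) → ((Fin n → ℝ) → G) → Prop
  | one : IsPlot A 0 fun _ => 1
  | mul {n : ℕ} {Φ : (Fin n → ℝ) → G} (Y : G) (hY : Y ∈ A) (h : IsPlot A n Φ) :
      IsPlot A (n + 1) fun t => S.dil (t 0) Y * Φ (Fin.tail t)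

/-- The maps `v ↦ δ_{c₁(v)}(Y₁) ⋯ δ_{cₙ(v)}(Yₙ)` with `Yᵢ ∈ A` and functions `cᵢ` that are
differentiable at the origin. -/
inductive FactorsThroughPlot {E : Type*} [NormedAddCommGroup E] [NormedSpace ℝ E] (A : Set G) :
    (E → G) → Prop
  | one : FactorsThroughPlot A fun _ => 1
  | mul {ψ : E → G} (Y : G) (hY : Y ∈ A) (c : E → ℝ) (hc : DifferentiableAt ℝ c 0)
      (h : FactorsThroughPlot A ψ) : FactorsThroughPlot A fun v => S.dil (c v) Y * ψ v

variable {S} {A : Set G}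

namespace FactorsThroughPlot

variable {E : Type*} [NormedAddCommGroup E] [NormedSpace ℝ E]

theorem mul' {ψ₁ ψ₂ : E → G} (h₁ : S.FactorsThroughPlot A ψ₁) (h₂ : S.FactorsThroughPlot A ψ₂) :
    S.FactorsThroughPlot A fun v => ψ₁ v * ψ₂ v := by
  induction h₁ with
  | one => simpa using h₂
  | mul Y hY c hc _ ih => simpa only [mul_assoc] using ih.mul Y hY c hc

theorem dil {Y : G} (hY : Y ∈ A) {c : E → ℝ} (hc : DifferentiableAt ℝ c 0) :
    S.FactorsThroughPlot A fun v => S.dil (c v) Y := by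
  simpa using (one (S := S) (A := A) (E := E)).mul Y hY c hc

theorem exists_plot {ψ : E → G} (h : S.FactorsThroughPlot A ψ) :
    ∃ (n : ℕ) (Φ : (Fin n → ℝ) → G) (ι : E → Fin n → ℝ), S.IsPlot A n Φ ∧
      DifferentiableAt ℝ ι 0 ∧ ψ = fun v => Φ (ι v) := by
  induction h with
  | one => exact ⟨0, _, fun _ => 0, .one, by fun_prop, rfl⟩
  | mul Y hY c hc _ ih =>
    obtain ⟨n, Φ, ι, hΦ, hι, rfl⟩ := ih
    refine ⟨n + 1, _, fun v => Fin.cons (c v) (ι v), hΦ.mul Y hY, ?_, by simp⟩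
    rw [differentiableAt_pi] at hι ⊢
    exact Fin.cases (by simp [hc]) (by simpa using hι)

end FactorsThroughPlot

/-- The group generated by the one-parameter subgroups through the points of `A`. -/
def lineGroup (S : ScalableStructure G) (A : Set G) : Subgroup G :=
  Subgroup.closure {g | ∃ a ∈ A, ∃ t : ℝ, g = S.dil t a}

theorem dil_neg_of_mem_firstLayer {Y : G} (hY : Y ∈ S.firstLayer) (t : ℝ) :
    S.dil (-t) Y = (S.dil t Y)⁻¹ := by
  have := hY (-t) t
  rw [neg_add_cancel, S.dil_zero] at this
  exact eq_inv_of_mul_eq_one_left this.symm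

theorem FactorsThroughPlot.const {E : Type*} [NormedAddCommGroup E] [NormedSpace ℝ E]
    (hA : A ⊆ S.firstLayer) {h : G} (hh : h ∈ S.lineGroup A) :
    S.FactorsThroughPlot A fun _ : E => h := by
  induction hh using Subgroup.closure_induction_left with
  | one => exact .one
  | mul_left x hx y _ ih =>
    obtain ⟨a, ha, t, rfl⟩ := hx
    exact ih.mul a ha (fun _ => t) (by fun_prop)
  | inv_mul_cancel x hx y _ ih =>
    obtain ⟨a, ha, t, rfl⟩ := hx
    rw [← dil_neg_of_mem_firstLayer (hA ha)]
    exact ih.mul a ha (fun _ => -t) (by fun_prop)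

/-- A global chart of a subgroup of `G` in which the multiplication is continuously
differentiable. -/
structure _root_.SmoothChart (G : Type*) [Group G] (F : Type*) [NormedAddCommGroup F]
    [NormedSpace ℝ F] where
  /-- the parametrization -/
  exp : F → G
  /-- the product in coordinates -/
  mul : F × F → F
  injective : Function.Injective exp
  exp_mul : ∀ p, exp (mul p) = exp p.1 * exp p.2
  exp_zero : exp 0 = 1
  contDiff_mul : ContDiff ℝ 1 mul

section Chart

variable {F : Type*} [NormedAddCommGroup F] [NormedSpace ℝ F] (c : SmoothChart G F)

omit [TopologicalSpace G] in
-- Multiplication restricts to the identity on both coordinate axes, which determines its derivative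
-- at the origin.
theorem _root_.SmoothChart.hasFDerivAt_mul :
    HasFDerivAt c.mul (ContinuousLinearMap.fst ℝ F F + ContinuousLinearMap.snd ℝ F F) (0, 0) := by
  have h := (c.contDiff_mul.differentiable one_ne_zero (0, 0)).hasFDerivAt
  have h1 : (fun x : F => c.mul (x, 0)) = id := by
    ext1 x; apply c.injective; simp [c.exp_mul, c.exp_zero]
  have h2 : (fun x : F => c.mul (0, x)) = id := by
    ext1 x; apply c.injective; simp [c.exp_mul, c.exp_zero]
  have e1 : (fderiv ℝ c.mul (0, 0)).comp (ContinuousLinearMap.inl ℝ F F) = .id ℝ F := by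
    have := HasFDerivAt.comp (f := fun x : F => (x, (0 : F))) (0 : F) h
      (hasFDerivAt_prodMk_left 0 0)
    refine this.unique ?_
    rw [show c.mul ∘ (fun x : F => (x, (0 : F))) = id from h1]
    exact hasFDerivAt_id 0
  have e2 : (fderiv ℝ c.mul (0, 0)).comp (ContinuousLinearMap.inr ℝ F F) = .id ℝ F := by
    have := HasFDerivAt.comp (f := fun x : F => ((0 : F), x)) (0 : F) h
      (hasFDerivAt_prodMk_right 0 0)
    refine this.unique ?_
    rw [show c.mul ∘ (fun x : F => ((0 : F), x)) = id from h2]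
    exact hasFDerivAt_id 0
  refine h.congr_fderiv ?_
  ext x
  · simpa using DFunLike.congr_fun e1 x
  · simpa using DFunLike.congr_fun e2 x

theorem IsPlot.exists_contDiff (hA : ∀ Y ∈ A, ∃ y : F, ∀ t : ℝ, S.dil t Y = c.exp (t • y)) {n : ℕ}
    {Φ : (Fin n → ℝ) → G} (h : S.IsPlot A n Φ) :
    ∃ f : (Fin n → ℝ) → F, ContDiff ℝ 1 f ∧ ∀ t, Φ t = c.exp (f t) := by
  induction h with
  | one => exact ⟨fun _ => 0, contDiff_const, fun _ => c.exp_zero.symm⟩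
  | @mul n Φ Y hY _ ih =>
    obtain ⟨f, hf, hfΦ⟩ := ih
    obtain ⟨y, hy⟩ := hA Y hY
    refine ⟨fun t => c.mul (t 0 • y, f (Fin.tail t)), c.contDiff_mul.comp
      (ContDiff.prodMk (by fun_prop) (hf.comp ?_)), fun t => ?_⟩
    · exact contDiff_pi.2 fun i => contDiff_apply ℝ ℝ i.succ
    · simp only [c.exp_mul, hy, hfΦ]

/-- If the conjugates of the generators by elements of the group they generate have tangent vectors
that span the chart, then some product of one-parameter subgroups is a submersion at some point. -/
theorem exists_plot_surjective [FiniteDimensional ℝ F] (hA : A ⊆ S.firstLayer)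
    (hAc : ∀ Y ∈ A, ∃ y : F, ∀ t : ℝ, S.dil t Y = c.exp (t • y))
    (hspan : Submodule.span ℝ {w : F | ∃ h ∈ S.lineGroup A, ∃ Y ∈ A, ∃ f : ℝ → F,
      HasDerivAt f w 0 ∧ ∀ t, h * S.dil t Y * h⁻¹ = c.exp (f t)} = ⊤) :
    ∃ (n : ℕ) (Φ : (Fin n → ℝ) → G) (f : (Fin n → ℝ) → F) (t₀ : Fin n → ℝ), S.IsPlot A n Φ ∧
      ContDiff ℝ 1 f ∧ (∀ t, Φ t = c.exp (f t)) ∧ Function.Surjective (fderiv ℝ f t₀) := by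
  set W := {w : F | ∃ h ∈ S.lineGroup A, ∃ Y ∈ A, ∃ f : ℝ → F,
      HasDerivAt f w 0 ∧ ∀ t, h * S.dil t Y * h⁻¹ = c.exp (f t)} with hW
  obtain ⟨T, hTW, hT⟩ := (Submodule.fg_span_iff_fg_span_finset_subset W).1
    (hspan ▸ (Module.finite_def.1 inferInstance))
  rw [hspan] at hT
  -- A product of conjugated lines with tangents `w_i` has derivative `v ↦ ∑ v_i w_i` at the origin,
  -- because multiplication is addition to first order.
  have key : ∀ l : List T, ∃ (ψ : (T → ℝ) → G) (f : (T → ℝ) → F), S.FactorsThroughPlot A ψ ∧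
      (∀ v, ψ v = c.exp (f v)) ∧ f 0 = 0 ∧ HasFDerivAt f
        (l.map fun i : T => (ContinuousLinearMap.proj (R := ℝ) (φ := fun _ : T => ℝ) i).smulRight
          (i : F)).sum 0 := by
    intro l
    induction l with
    | nil => exact ⟨_, fun _ => 0, .one, fun _ => c.exp_zero.symm, rfl, hasFDerivAt_const _ _⟩
    | cons i l ih =>
      obtain ⟨ψ, f, hψ, hf, hf0, hfd⟩ := ih
      obtain ⟨h, hh, Y, hY, g, hg, hgc⟩ := hTW i.2
      have hg0 : g 0 = 0 := by
        apply c.injective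
        rw [← hgc, S.dil_zero, mul_one, mul_inv_cancel, c.exp_zero]
      have hh' : S.FactorsThroughPlot A fun v : T → ℝ => h * S.dil (v i) Y * h⁻¹ :=
        ((FactorsThroughPlot.const hA hh).mul' (.dil hY (by fun_prop))).mul'
          (.const hA (inv_mem hh))
      refine ⟨_, fun v => c.mul (g (v i), f v), hh'.mul' hψ, fun v => ?_, ?_, ?_⟩
      · rw [c.exp_mul, hgc, hf]
      · apply c.injective
        simp [c.exp_mul, hg0, hf0, c.exp_zero]
      · have h1 : HasFDerivAt (fun v : T → ℝ => g (v i))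
            ((ContinuousLinearMap.proj (R := ℝ) (φ := fun _ : T => ℝ) i).smulRight (i : F)) 0 := by
          have h2 : HasFDerivAt (fun v : T → ℝ => v i)
            (ContinuousLinearMap.proj (R := ℝ) (φ := fun _ : T => ℝ) i) 0 := hasFDerivAt_apply i 0
          have hg' : HasFDerivAt g (ContinuousLinearMap.toSpanSingleton ℝ (i : F))
            ((0 : T → ℝ) i) := hg.hasFDerivAt
          refine (hg'.comp (0 : T → ℝ) h2).congr_fderiv ?_
          ext v
          simp
        have h3 := c.hasFDerivAt_mul
        rw [show ((0 : F), (0 : F)) = (g ((0 : T → ℝ) i), f 0) by simp [hg0, hf0]] at h3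
        refine (h3.comp (0 : T → ℝ) (h1.prodMk hfd)).congr_fderiv ?_
        ext v
        simp
  obtain ⟨ψ, f, hψ, hf, -, hfd⟩ := key Finset.univ.toList
  -- The conjugating elements are words in the generators, so the product is a plot composed with a
  -- map `ι` of the times. The derivative of the composite is onto, hence so is that of the plot at
  -- `ι 0`.
  obtain ⟨n, Φ, ι, hΦ, hι, rfl⟩ := hψ.exists_plot
  obtain ⟨f', hf', hf'Φ⟩ := hΦ.exists_contDiff c hAc
  refine ⟨n, Φ, f', ι 0, hΦ, hf', hf'Φ, ?_⟩
  have hff' : f = fun v => f' (ι v) := by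
    ext1 v
    apply c.injective
    rw [← hf, ← hf'Φ]
  rw [hff'] at hfd
  have huniq := hfd.unique
    ((hf'.differentiable one_ne_zero (ι 0)).hasFDerivAt.comp (0 : T → ℝ) hι.hasFDerivAt)
  have hsurj : Function.Surjective ((fderiv ℝ f' (ι 0)).comp (fderiv ℝ ι 0)) := by
    rw [← huniq, Finset.sum_map_toList]
    intro w
    have hw : w ∈ Submodule.span ℝ (T : Set F) := by rw [← hT]; trivial
    rw [Submodule.mem_span_finset'] at hw
    obtain ⟨a, ha⟩ := hw
    exact ⟨a, by simpa [sum_apply] using ha⟩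
  exact Function.Surjective.of_comp (g := fderiv ℝ ι 0) hsurj

end Chart

end ScalableStructure

/-! ### Smooth global charts of Carnot subgroups. -/

section ContDiffBCH

variable {L : Type*} [LieRing L] [LieAlgebra ℝ L] {F : Type*} [NormedAddCommGroup F]
  [NormedSpace ℝ F] [FiniteDimensional ℝ F] (φ : L ≃ₗ[ℝ] F)

theorem contDiff_lie_coord {E : Type*} [NormedAddCommGroup E] [NormedSpace ℝ E] {n : WithTop ℕ∞}
    {f g : E → L} (hf : ContDiff ℝ n fun v => φ (f v)) (hg : ContDiff ℝ n fun v => φ (g v)) :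
    ContDiff ℝ n fun v => φ ⁅f v, g v⁆ := by
  let B : F →ₗ[ℝ] F →ₗ[ℝ] F := LinearMap.mk₂ ℝ (fun x y => φ ⁅φ.symm x, φ.symm y⁆)
    (by simp) (by simp) (by simp) (by simp)
  have h := (ContinuousLinearMap.contDiff (n := n) B.toContinuousBilinearMap).comp hf
  have := h.clm_apply hg
  simpa [B] using this

theorem contDiff_nestedBracket_coord {E : Type*} [NormedAddCommGroup E] [NormedSpace ℝ E]
    {n : WithTop ℕ∞} :
    ∀ l : List (E → L), (∀ f ∈ l, ContDiff ℝ n fun v => φ (f v)) →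
      ContDiff ℝ n fun v => φ (nestedBracket (l.map fun f => f v))
  | [], _ => by simpa [nestedBracket] using contDiff_const
  | [f], h => by simpa [nestedBracket] using h f (by simp)
  | f :: g :: l, h => by
    have h1 := contDiff_nestedBracket_coord (g :: l) fun f' hf' => h f' (by simp [hf'])
    exact contDiff_lie_coord φ (h f (by simp)) h1

theorem contDiff_bch_coord (N : ℕ) {n : WithTop ℕ∞} :
    ContDiff ℝ n fun p : F × F => φ (bch N (φ.symm p.1) (φ.symm p.2)) := by
  simp only [bch_def, map_sum, map_smul]
  refine ContDiff.sum fun k _ => ContDiff.const_smul _ (ContDiff.sum fun p _ =>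
    ContDiff.const_smul _ ?_)
  have := contDiff_nestedBracket_coord (E := F × F) (n := n) φ
    (dynkinWord (fun q => φ.symm q.1) (fun q => φ.symm q.2) p) fun f hf => by
      rcases eq_or_eq_of_mem_dynkinWord hf with rfl | rfl
      · simpa using contDiff_fst
      · simpa using contDiff_snd
  simpa only [map_dynkinWord] using this

end ContDiffBCH

theorem HasDerivAt.mem_submodule {F : Type*} [NormedAddCommGroup F] [NormedSpace ℝ F]
    [FiniteDimensional ℝ F] {f : ℝ → F} {w : F} {t : ℝ} (h : HasDerivAt f w t)
    (M : Submodule ℝ F) (hM : ∀ s, f s ∈ M) : w ∈ M := by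
  have hclosed : IsClosed (M : Set F) := M.closed_of_finiteDimensional
  refine hclosed.mem_of_tendsto (hasDerivAt_iff_tendsto_slope.1 h) (Eventually.of_forall fun s => ?_)
  exact M.smul_mem _ (M.sub_mem (hM s) (hM t))

namespace ScalableStructure

variable {G : Type*} [Group G] [TopologicalSpace G] {S : ScalableStructure G}

theorem dil_one (g : G) : S.dil 1 g = g := by
  apply (S.bijective_dil 1 one_ne_zero).1
  rw [S.dil_dil, one_mul]

theorem continuous_dil_left (Y : G) : Continuous fun t : ℝ => S.dil t Y :=
  S.continuous_dil.comp (Continuous.prodMk continuous_id continuous_const)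

theorem continuous_dil_right (r : ℝ) : Continuous fun g : G => S.dil r g :=
  S.continuous_dil.comp (Continuous.prodMk continuous_const continuous_id)

/-- A Carnot subgroup that is generated by elements of the first layer has a global smooth chart in
which the one-parameter subgroups of the generators are lines, and in which the conjugates of the
generators have tangent vectors that span. -/
theorem IsCarnotSubgroup.exists_chart [IsTopologicalGroup G] {A : Set G}
    (hH : S.IsCarnotSubgroup (S.generated A)) (hA : A ⊆ S.firstLayer) :
    ∃ (d : ℕ) (c : SmoothChart G (Fin d → ℝ)) (ε : (Fin d → ℝ) ≃ₜ S.generated A),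
      (∀ v, c.exp v = ε v) ∧ (∀ Y ∈ A, ∃ y, ∀ t : ℝ, S.dil t Y = c.exp (t • y)) ∧
      Submodule.span ℝ {w | ∃ h ∈ S.lineGroup A, ∃ Y ∈ A, ∃ f : ℝ → Fin d → ℝ,
        HasDerivAt f w 0 ∧ ∀ t, h * S.dil t Y * h⁻¹ = c.exp (f t)} = ⊤ := by
  have hHcl : (S.generated A : Set G) = closure (S.lineGroup A : Set G) := rfl
  generalize S.generated A = H at hH hHcl ⊢
  obtain ⟨⟨hclosed, -⟩, L, _, _, _, _, _, _, _, V, e, he, hdil⟩ := hH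
  have hlineH : S.lineGroup A ≤ H := by
    intro g hg
    have := subset_closure (s := (S.lineGroup A : Set G)) hg
    rwa [← hHcl] at this
  have hAline : ∀ Y ∈ A, ∀ t, S.dil t Y ∈ S.lineGroup A := fun Y hY t =>
    Subgroup.subset_closure ⟨Y, hY, t, rfl⟩
  have hAH : ∀ Y ∈ A, Y ∈ H := fun Y hY => hlineH (by simpa [dil_one] using hAline Y hY 1)
  set φ : L ≃ₗ[ℝ] (Fin (Module.finrank ℝ L) → ℝ) := (Module.finBasis ℝ L).equivFun
  have hφc : Continuous φ := LinearMap.continuous_of_finiteDimensional φ.toLinearMap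
  have hφsc : Continuous φ.symm := LinearMap.continuous_of_finiteDimensional φ.symm.toLinearMap
  let φh : (Fin (Module.finrank ℝ L) → ℝ) ≃ₜ L :=
    { φ.symm.toEquiv with continuous_toFun := hφsc, continuous_invFun := hφc }
  let ε := φh.trans e
  have hε : ∀ v, ε v = e (φ.symm v) := fun v => rfl
  have he0 : e 0 = 1 := V.exp_zero e.toEquiv he
  let c : SmoothChart G (Fin (Module.finrank ℝ L) → ℝ) :=
    { exp := fun v => ε v
      mul := fun p => φ (bch V.step (φ.symm p.1) (φ.symm p.2))
      injective := Subtype.val_injective.comp ε.injective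
      exp_mul := fun p => by simp [hε, he]
      exp_zero := by simp [hε, he0]
      contDiff_mul := contDiff_bch_coord φ _ }
  have hcε : ∀ v, c.exp v = e (φ.symm v) := fun v => rfl
  have hcs : ∀ (t : ℝ) x, c.exp (t • φ x) = e (t • x) := fun t x => by
    rw [hcε, φ.symm.map_smul, φ.symm_apply_apply]
  set AL : Set L := {x | (e x : G) ∈ A} with hAL
  have hAL1 : ∀ x ∈ AL, x ∈ V.layer 1 := by
    intro x hx
    -- For `Y` in `V₁(G)`, dilation by `2` is squaring, which is doubling in exponential
    -- coordinates.
    apply V.mem_layer_one_of_dilation_two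
    apply e.injective
    apply Subtype.val_injective
    rw [hdil, ← V.bch_self, he, ← one_add_one_eq_two, hA hx 1 1, dil_one, Subgroup.coe_mul]
  have hALdil : ∀ x ∈ AL, ∀ t : ℝ, S.dil t (e x) = e (t • x) := by
    intro x hx t
    rw [← hdil, V.dilation_of_mem t 1 x (hAL1 x hx), pow_one]
  have hAx : ∀ Y ∈ A, ∃ x ∈ AL, (e x : G) = Y := fun Y hY =>
    ⟨e.symm ⟨Y, hAH Y hY⟩, by simpa [hAL] using hY, by simp⟩
  -- The span `U` of the generators plus `tail 2` is stable under the product and closed, so it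
  -- contains the closure of the generated group, which is everything. Then `U` fills the first
  -- layer because this meets `tail 2` trivially.
  have hspan1 : V.layer 1 = Submodule.span ℝ AL := by
    set U := Submodule.span ℝ AL with hU
    have hUle : U ≤ V.layer 1 := Submodule.span_le.2 hAL1
    set M := U ⊔ V.tail 2 with hM
    have hMmul : ∀ x ∈ M, ∀ y ∈ M, bch V.step x y ∈ M := by
      intro x hx y hy
      have h1 := V.bch_sub_add_mem_tail (x := x) (y := y) le_rfl le_rfl (by simp [V.tail_one])
        (by simp [V.tail_one])
      have := M.add_mem ((le_sup_right : V.tail 2 ≤ M) h1) (M.add_mem hx hy)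
      rwa [sub_add_cancel] at this
    have hline : ∀ g ∈ S.lineGroup A, ∃ x ∈ M, (e x : G) = g := by
      intro g hg
      have hmul : ∀ Y ∈ A, ∀ t : ℝ, ∀ y, (∃ x ∈ M, (e x : G) = y) →
          ∃ x ∈ M, (e x : G) = S.dil t Y * y := by
        rintro Y hY t _ ⟨x, hx, rfl⟩
        obtain ⟨z, hz, rfl⟩ := hAx Y hY
        refine ⟨_, hMmul (t • z) (M.smul_mem t (le_sup_left (a := U)
          (Submodule.subset_span hz))) x hx, ?_⟩
        rw [he, Subgroup.coe_mul, hALdil z hz]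
      induction hg using Subgroup.closure_induction_left with
      | one => exact ⟨0, M.zero_mem, by simp [he0]⟩
      | mul_left x hx y _ ih =>
        obtain ⟨a, ha, t, rfl⟩ := hx
        exact hmul a ha t _ ih
      | inv_mul_cancel x hx y _ ih =>
        obtain ⟨a, ha, t, rfl⟩ := hx
        rw [← dil_neg_of_mem_firstLayer (hA ha)]
        exact hmul a ha (-t) _ ih
    have hMcl : IsClosed ((fun x : H => (x : G)) '' (e.symm ⁻¹' (M : Set L))) :=
      hclosed.isClosedMap_subtype_val _
        ((M.closed_of_finiteDimensional).preimage e.symm.continuous)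
    have hMtop : M = ⊤ := by
      rw [eq_top_iff]
      rintro x -
      have hsub : (H : Set G) ⊆ (fun x : H => (x : G)) '' (e.symm ⁻¹' (M : Set L)) := by
        rw [hHcl]
        refine closure_minimal ?_ hMcl
        intro g hg
        obtain ⟨x, hx, rfl⟩ := hline g hg
        exact ⟨e x, by simpa using hx, rfl⟩
      obtain ⟨h, hh, hhx⟩ := hsub (e x).2
      have : h = e x := Subtype.val_injective hhx
      rw [this] at hh
      simpa using hh
    refine le_antisymm ?_ hUle
    intro x hx
    have hxM : x ∈ M := by rw [hMtop]; trivial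
    obtain ⟨u, hu, z, hz, rfl⟩ := Submodule.mem_sup.1 hxM
    have hz1 : z ∈ V.layer 1 := by
      have := (V.layer 1).sub_mem hx (hUle hu)
      rwa [add_sub_cancel_left] at this
    have := (Submodule.disjoint_def.1 (V.disjoint_layer_tail 1)) z hz1 hz
    rwa [this, add_zero]
  refine ⟨_, c, ε, fun v => rfl, fun Y hY => ?_, ?_⟩
  · obtain ⟨x, hx, rfl⟩ := hAx Y hY
    exact ⟨φ x, fun t => by rw [hALdil x hx, hcs]⟩
  set W : Set (Fin (Module.finrank ℝ L) → ℝ) := {w | ∃ h ∈ S.lineGroup A, ∃ Y ∈ A,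
    ∃ f : ℝ → Fin (Module.finrank ℝ L) → ℝ,
      HasDerivAt f w 0 ∧ ∀ t, h * S.dil t Y * h⁻¹ = c.exp (f t)} with hW
  -- Applied to the span of the tangent vectors of conjugated lines: conjugation by `1` gives the
  -- generators, and `symm_conj` gives the leading terms of the others.
  have hD := V.eq_top_of_leading_conj e.toEquiv ((S.lineGroup A).subgroupOf H) AL he hspan1
    (fun x hx => by
      rw [Subgroup.mem_subgroupOf]
      have := hAline _ hx 1
      rwa [dil_one] at this)
    ((Submodule.span ℝ W).comap φ.toLinearMap) (fun x hx => by
      refine Submodule.subset_span ⟨1, Subgroup.one_mem _, e x, hx, fun t => t • φ x, ?_, ?_⟩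
      · simpa using (hasDerivAt_id (0 : ℝ)).smul_const (φ x)
      · intro t
        rw [one_mul, inv_one, mul_one, hALdil x hx, hcs])
    (fun h hh x hx i hi hhi => by
      let f : ℝ → Fin (Module.finrank ℝ L) → ℝ := fun t =>
        c.mul (φ (e.symm h), c.mul (t • φ x, φ (e.symm h⁻¹)))
      have hf : ContDiff ℝ 1 f := c.contDiff_mul.comp (contDiff_const.prodMk
        (c.contDiff_mul.comp (ContDiff.prodMk (by fun_prop) contDiff_const)))
      have hfexp : ∀ t, (h : G) * S.dil t (e x) * (h : G)⁻¹ = c.exp (f t) := by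
        intro t
        rw [c.exp_mul, c.exp_mul, hcε, hcε, hcε, mul_assoc]
        simp [hALdil x hx]
      have hfd := (hf.differentiable one_ne_zero 0).hasDerivAt
      refine ⟨φ.symm (deriv f 0), ?_, ?_⟩
      · rw [Submodule.mem_comap]
        refine Submodule.subset_span ⟨h, hh, e x, hx, f, ?_, hfexp⟩
        simpa using hfd
      · have hfs : ∀ t : ℝ, f t = φ (e.symm (h * e (t • x) * h⁻¹)) := by
          intro t
          apply c.injective
          rw [← hfexp, hcε, φ.symm_apply_apply, hALdil x hx]
          simp
        -- The conjugated line minus its linear leading part stays in the subspace `tail (i + 2)`,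
        -- hence so does its derivative.
        have hmem := HasDerivAt.mem_submodule (hfd.sub
          ((hasDerivAt_id (0 : ℝ)).smul_const (φ (x + ⁅e.symm h, x⁆))))
          ((V.tail (i + 2)).map φ.toLinearMap) (fun t => by
            refine ⟨_, V.symm_conj e.toEquiv he hi hhi (e (t • x)), ?_⟩
            have h2 : e.toEquiv.symm (e (t • x)) = t • x := e.toEquiv.symm_apply_apply _
            simp only [h2, lie_smul, ← smul_add, id, Pi.sub_apply, hfs]
            simp)
        obtain ⟨z, hz, hzw⟩ := hmem
        have : φ.symm (deriv f 0) - (x + ⁅e.symm h, x⁆) = z := by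
          apply φ.injective
          have : φ z = _ := hzw
          rw [this]
          simp
        change φ.symm (deriv f 0) - (x + ⁅e.symm h, x⁆) ∈ _
        rw [this]
        exact hz)
  rw [eq_top_iff]
  rintro w -
  have : φ.symm w ∈ (Submodule.span ℝ W).comap φ.toLinearMap := by rw [hD]; trivial
  simpa using this

end ScalableStructure

/-! ### Absolutely continuous convolutions of uniform laws on segments. -/

open scoped ENNReal NNReal

/-- Near a point where the derivative is surjective, preimages of null sets are null. -/
theorem exists_closedBall_preimage_null {n d : ℕ} {f : (Fin n → ℝ) → Fin d → ℝ}
    {t₀ : Fin n → ℝ} (hf : ContDiffAt ℝ 1 f t₀) (hsurj : Function.Surjective (fderiv ℝ f t₀)) :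
    ∃ r > 0, ∀ s : Set (Fin d → ℝ), MeasurableSet s → volume s = 0 →
      volume (Metric.closedBall t₀ r ∩ f ⁻¹' s) = 0 := by
  have hfd := hf.hasStrictFDerivAt one_ne_zero
  set D := fderiv ℝ f t₀ with hD
  obtain ⟨R, hR⟩ := D.toLinearMap.exists_rightInverse_of_surjective (LinearMap.range_eq_top.2 hsurj)
  let R' : (Fin d → ℝ) →L[ℝ] (Fin n → ℝ) := R.toContinuousLinearMap
  have hDR : ∀ y, D (R' y) = y := fun y => DFunLike.congr_fun hR y
  let Ψ : (Fin n → ℝ) → Fin n → ℝ := fun t => R' (f t) + (t - R' (D t))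
  have hΨ : HasStrictFDerivAt Ψ
      ((ContinuousLinearEquiv.refl ℝ (Fin n → ℝ) : (Fin n → ℝ) ≃L[ℝ] (Fin n → ℝ)) :
        (Fin n → ℝ) →L[ℝ] (Fin n → ℝ)) t₀ := by
    have h1 : HasStrictFDerivAt Ψ (R'.comp D + (.id ℝ _ - R'.comp D)) t₀ :=
      (R'.hasStrictFDerivAt.comp t₀ hfd).add
        ((hasStrictFDerivAt_id t₀).sub (R'.comp D).hasStrictFDerivAt)
    refine h1.congr_fderiv ?_
    ext v
    simp
  have hDΨ : ∀ t, D (Ψ t) = f t := fun t => by simp [Ψ, hDR]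
  obtain ⟨s, hs, hsΨ⟩ : ∃ s ∈ 𝓝 t₀, ∃ K, AntilipschitzWith K (s.domRestrict Ψ) := by
    rcases subsingleton_or_nontrivial (Fin n → ℝ) with h | h
    · exact ⟨_, univ_mem, 0, fun x y => by simp [Subsingleton.elim x y]⟩
    · set N := ‖(((ContinuousLinearEquiv.refl ℝ (Fin n → ℝ)).symm :
        (Fin n → ℝ) ≃L[ℝ] (Fin n → ℝ)) : (Fin n → ℝ) →L[ℝ] (Fin n → ℝ))‖₊⁻¹ with hN
      have hNpos : 0 < N := by
        have := (ContinuousLinearEquiv.refl ℝ (Fin n → ℝ)).subsingleton_or_nnnorm_symm_pos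
        rcases this with h' | h'
        · exact absurd h' (not_subsingleton _)
        · exact inv_pos.2 h'
      obtain ⟨s, hs, hsΨ⟩ := hΨ.approximates_deriv_on_nhds (c := N / 2) (Or.inr (half_pos hNpos))
      exact ⟨s, hs, _, hsΨ.antilipschitz (Or.inr (half_lt_self hNpos))⟩
  obtain ⟨K, hK⟩ := hsΨ
  obtain ⟨r, hr, hrs⟩ := Metric.nhds_basis_closedBall.mem_iff.1 hs
  refine ⟨r, hr, fun A hA hA0 => ?_⟩
  have h1 : volume (D ⁻¹' A) = 0 := by
    have h := (ae_comp_linearMap_mem_iff D.toLinearMap volume volume hsurj hA.compl).2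
      (by rw [ae_iff]; simpa using hA0)
    rw [ae_iff] at h
    simp only [Set.mem_compl_iff, not_not] at h
    exact h
  -- Lebesgue measure is rewritten as Hausdorff measure, for which preimages of null sets under an
  -- antilipschitz map are null.
  have hH : (volume : Measure (Fin n → ℝ)) = Measure.hausdorffMeasure (n : ℝ) := by
    have := hausdorffMeasure_pi_real (ι := Fin n)
    rw [Fintype.card_fin] at this
    exact this.symm
  refine measure_mono_null (t := s ∩ f ⁻¹' A) (Set.inter_subset_inter_left _ hrs) ?_
  rw [hH] at h1 ⊢
  have h2 := hK.hausdorffMeasure_preimage_le (Nat.cast_nonneg n) (D ⁻¹' A)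
  rw [h1, mul_zero, nonpos_iff_eq_zero] at h2
  have h3 := (isometry_subtype_coe (s := s)).hausdorffMeasure_image (d := (n : ℝ))
    (Or.inl (Nat.cast_nonneg n)) (s.domRestrict Ψ ⁻¹' (D ⁻¹' A))
  rw [h2] at h3
  refine measure_mono_null ?_ h3
  rintro t ⟨hts, htA⟩
  refine ⟨⟨t, hts⟩, ?_, rfl⟩
  change D (Ψ t) ∈ A
  rw [hDΨ]
  exact htA

/-- Balls of the sup norm are cubes, so the product of uniform laws is a constant multiple of
Lebesgue measure on the ball. -/
theorem cond_Icc_pi {n : ℕ} (t₀ : Fin n → ℝ) {r : ℝ} (hr : 0 < r) :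
    (Measure.pi fun i => ProbabilityTheory.cond volume (Set.Icc (t₀ i - r) (t₀ i + r))) ≪
      volume.restrict (Metric.closedBall t₀ r) := by
  have hball : Metric.closedBall t₀ r = Set.univ.pi fun i => Set.Icc (t₀ i - r) (t₀ i + r) := by
    rw [closedBall_pi _ hr.le]
    simp [Real.closedBall_eq_Icc]
  have : (Measure.pi fun i => ProbabilityTheory.cond volume (Set.Icc (t₀ i - r) (t₀ i + r))) =
      (∏ i, (volume (Set.Icc (t₀ i - r) (t₀ i + r)))⁻¹) •
        volume.restrict (Metric.closedBall t₀ r) := by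
    refine (Measure.pi_eq fun s hs => ?_)
    rw [hball, volume_pi, Measure.restrict_pi_pi, Measure.smul_apply, Measure.pi_pi, smul_eq_mul,
      ← Finset.prod_mul_distrib]
    rfl
  rw [this]
  exact Measure.smul_absolutelyContinuous

namespace ScalableStructure

variable {G : Type*} [Group G] [TopologicalSpace G] [MeasurableSpace G]

/-- The uniform distribution on the segment `{δ_t(Y) | a ≤ t ≤ b}`. -/
def lineMeasure (S : ScalableStructure G) (Y : G) (a b : ℝ) : Measure G :=
  (ProbabilityTheory.cond volume (Set.Icc a b)).map fun t => S.dil t Y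

/-- Finite convolutions of uniform distributions on segments in directions of `A`. -/
inductive IsLineConv (S : ScalableStructure G) (A : Set G) : Measure G → Prop
  | one : IsLineConv S A (Measure.dirac 1)
  | mul {ν : Measure G} (Y : G) (hY : Y ∈ A) (a b : ℝ) (hab : a < b) (h : IsLineConv S A ν) :
      IsLineConv S A ((S.lineMeasure Y a b).mconv ν)

variable {S : ScalableStructure G} {A : Set G}

theorem isProbabilityMeasure_cond_Icc {a b : ℝ} (hab : a < b) :
    IsProbabilityMeasure (ProbabilityTheory.cond (volume : Measure ℝ) (Set.Icc a b)) :=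
  ProbabilityTheory.cond_isProbabilityMeasure_of_finite
    (by simpa using hab) (by simp)

omit [MeasurableSpace G] in
theorem IsPlot.continuous [IsTopologicalGroup G] {n : ℕ} {Φ : (Fin n → ℝ) → G}
    (h : S.IsPlot A n Φ) : Continuous Φ := by
  induction h with
  | one => exact continuous_const
  | mul Y hY _ ih =>
    refine ((continuous_dil_left Y).comp (continuous_apply 0)).mul (ih.comp ?_)
    exact continuous_pi fun i => continuous_apply i.succ

/-- Independent uniform times make the factors of a plot independent, so the law of their product is
the convolution of the laws on segments. -/
theorem IsPlot.isLineConv [IsTopologicalGroup G] [BorelSpace G] [MeasurableMul₂ G] {n : ℕ}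
    {Φ : (Fin n → ℝ) → G} (h : S.IsPlot A n Φ) (t₀ : Fin n → ℝ) {r : ℝ} (hr : 0 < r) :
    S.IsLineConv A ((Measure.pi fun i =>
      ProbabilityTheory.cond volume (Set.Icc (t₀ i - r) (t₀ i + r))).map Φ) := by
  have hprob : ∀ s : ℝ, IsProbabilityMeasure
      (ProbabilityTheory.cond (volume : Measure ℝ) (Set.Icc (s - r) (s + r))) := fun s =>
    isProbabilityMeasure_cond_Icc (by linarith)
  induction h with
  | one =>
    have : IsProbabilityMeasure (Measure.pi fun i =>
      ProbabilityTheory.cond volume (Set.Icc (t₀ i - r) (t₀ i + r))) := inferInstance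
    rw [Measure.map_const, measure_univ, one_smul]
    exact .one
  | @mul n Φ Y hY hΦ ih =>
    have hΦm := hΦ.continuous.measurable
    have hdm := (S.continuous_dil_left Y).measurable
    have key := (ih (Fin.tail t₀)).mul Y hY (t₀ 0 - r) (t₀ 0 + r) (by linarith)
    convert key using 1
    have hmp := measurePreserving_piFinSuccAbove (fun i : Fin (n + 1) =>
      ProbabilityTheory.cond (volume : Measure ℝ) (Set.Icc (t₀ i - r) (t₀ i + r))) 0
    rw [lineMeasure, Measure.mconv, Measure.map_prod_map _ _ hdm hΦm,
      Measure.map_map measurable_mul (hdm.prodMap hΦm)]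
    change _ = Measure.map _ (Measure.prod _ (Measure.pi fun j : Fin n =>
      ProbabilityTheory.cond volume (Set.Icc (t₀ (Fin.succAbove 0 j) - r)
        (t₀ (Fin.succAbove 0 j) + r))))
    rw [← hmp.map_eq, Measure.map_map (measurable_mul.comp (hdm.prodMap hΦm)) hmp.measurable]
    rfl

/-- In a smooth global chart, Lebesgue measure is absolutely continuous with respect to Haar
measure. -/
theorem volume_preimage_eq_zero_of_haar [IsTopologicalGroup G] [BorelSpace G] [T2Space G]
    {H : Subgroup G} {d : ℕ} (c : SmoothChart G (Fin d → ℝ)) (ε : (Fin d → ℝ) ≃ₜ H)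
    (hε : ∀ v, c.exp v = ε v) (vol : Measure H) [vol.IsHaarMeasure] {s : Set H}
    (hs : MeasurableSet s) (hs0 : vol s = 0) : volume (ε ⁻¹' s) = 0 := by
  have : SecondCountableTopology H := ε.symm.secondCountableTopology
  have : LocallyCompactSpace H := ε.symm.isClosedEmbedding.locallyCompactSpace
  have hquasi : ∀ (a : Fin d → ℝ) (s : Set (Fin d → ℝ)), volume s = 0 →
      volume ((fun v => c.mul (a, v)) '' s) = 0 := fun a s hs =>
    addHaar_image_eq_zero_of_differentiableOn_of_addHaar_eq_zero volume
      ((c.contDiff_mul.differentiable one_ne_zero).comp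
        (by fun_prop : Differentiable ℝ fun v : Fin d → ℝ => (a, v))).differentiableOn hs
  have hmul : ∀ a v, ε (c.mul (a, v)) = ε a * ε v := fun a v => by
    apply Subtype.val_injective
    rw [← hε, c.exp_mul, hε, hε, Subgroup.coe_mul]
  set leb : Measure H := volume.map ε with hleb
  have hlebm : ∀ t : Set H, MeasurableSet t → leb t = volume (ε ⁻¹' t) := fun t ht => by
    rw [hleb, Measure.map_apply ε.continuous.measurable ht]
  have : SFinite leb := by rw [hleb]; infer_instance
  have hms : MeasurableSet {p : H × H | p.1 * p.2 ∈ s} := measurable_mul hs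
  -- Fubini in two orders: right translates of a Haar null set are Haar null, so some left translate
  -- of `s` is Lebesgue null. Left translations are `C¹` in the chart and bring the conclusion back
  -- to `s`.
  have hprod : (vol.prod leb) {p : H × H | p.1 * p.2 ∈ s} = 0 := by
    rw [Measure.prod_apply_symm hms]
    refine lintegral_eq_zero_of_ae_eq_zero (Eventually.of_forall fun y => ?_)
    exact (measure_mul_right_null vol y).2 hs0
  rw [Measure.measure_prod_null hms] at hprod
  obtain ⟨x, hx⟩ := hprod.exists
  change leb ((fun y => x * y) ⁻¹' s) = 0 at hx
  rw [hlebm _ (measurable_const_mul x hs)] at hx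
  refine measure_mono_null ?_ (hquasi (ε.symm x) _ hx)
  intro v hv
  refine ⟨ε.symm (x⁻¹ * ε v), ?_, ?_⟩
  · simpa using hv
  · apply ε.injective
    simp [hmul]

/-- Some finite convolution of uniform distributions on segments is absolutely continuous. -/
theorem IsCarnotSubgroup.exists_isLineConv_mem_acMeasures [IsTopologicalGroup G] [BorelSpace G]
    [T2Space G] [MeasurableMul₂ G]
    (hH : S.IsCarnotSubgroup (S.generated A)) (hA : A ⊆ S.firstLayer) :
    ∃ ν, S.IsLineConv A ν ∧ ν ∈ ACMeasures (S.generated A) := by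
  obtain ⟨d, c, ε, hε, hAc, hspan⟩ := hH.exists_chart hA
  obtain ⟨n, Φ, f, t₀, hΦ, hf, hfΦ, hsurj⟩ := exists_plot_surjective c hA hAc hspan
  obtain ⟨r, hr, hnull⟩ := exists_closedBall_preimage_null hf.contDiffAt hsurj
  have : LocallyCompactSpace (S.generated A) := ε.symm.isClosedEmbedding.locallyCompactSpace
  have hprob : ∀ s : ℝ, IsProbabilityMeasure
      (ProbabilityTheory.cond (volume : Measure ℝ) (Set.Icc (s - r) (s + r))) := fun s =>
    isProbabilityMeasure_cond_Icc (by linarith)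
  set π := Measure.pi fun i =>
    ProbabilityTheory.cond (volume : Measure ℝ) (Set.Icc (t₀ i - r) (t₀ i + r)) with hπ
  have hεf : Measurable fun t => ε (f t) := ε.continuous.measurable.comp hf.continuous.measurable
  refine ⟨_, hΦ.isLineConv t₀ hr, Measure.haar, π.map fun t => ε (f t), inferInstance,
    Measure.isProbabilityMeasure_map hεf.aemeasurable, ?_, ?_⟩
  · refine Measure.AbsolutelyContinuous.mk fun s hs hs0 => ?_
    rw [Measure.map_apply hεf hs]
    refine cond_Icc_pi t₀ hr ?_
    rw [Measure.restrict_apply (hεf hs), Set.inter_comm]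
    exact hnull _ (ε.continuous.measurable hs) (volume_preimage_eq_zero_of_haar c ε hε _ hs hs0)
  · rw [Measure.map_map measurable_subtype_coe hεf]
    congr 1
    ext1 t
    rw [hfΦ, hε]
    rfl

/-! ### The sigma-ideal of Aronszajn unions. -/

section Ideal

variable {G : Type*} [Group G] [TopologicalSpace G] [MeasurableSpace G] {S : ScalableStructure G}
  {X : ℕ → G}

/-- The sets that are unions of sets `Fᵢ ∈ 𝒜(Xᵢ)`. -/
def IsAronszajnUnion (S : ScalableStructure G) (X : ℕ → G) (E : Set G) : Prop :=
  ∃ F : ℕ → Set G, E = ⋃ i, F i ∧ ∀ i, F i ∈ S.AronszajnClass (X i)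

theorem AronszajnClass.mono {Y : G} {E E' : Set G} (h : E ∈ S.AronszajnClass Y)
    (hE' : MeasurableSet E') (hsub : E' ⊆ E) : E' ∈ S.AronszajnClass Y :=
  ⟨hE', fun g => measure_mono_null (fun _ ht => hsub ht) (h.2 g)⟩

theorem AronszajnClass.iUnion {ι : Type*} [Countable ι] {Y : G} {E : ι → Set G}
    (h : ∀ n, E n ∈ S.AronszajnClass Y) : ⋃ n, E n ∈ S.AronszajnClass Y := by
  refine ⟨.iUnion fun n => (h n).1, fun g => ?_⟩
  have : {t : ℝ | g * S.dil t Y ∈ ⋃ n, E n} = ⋃ n, {t : ℝ | g * S.dil t Y ∈ E n} := by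
    ext t; simp
  rw [this, measure_iUnion_null_iff]
  exact fun n => (h n).2 g

theorem AronszajnClass.empty (Y : G) : (∅ : Set G) ∈ S.AronszajnClass Y :=
  ⟨.empty, fun g => by simp⟩

namespace IsAronszajnUnion

theorem mono {E E' : Set G} (h : S.IsAronszajnUnion X E) (hE' : MeasurableSet E')
    (hsub : E' ⊆ E) : S.IsAronszajnUnion X E' := by
  obtain ⟨F, rfl, hF⟩ := h
  refine ⟨fun i => E' ∩ F i, ?_, fun i =>
    AronszajnClass.mono (hF i) (hE'.inter (hF i).1) Set.inter_subset_right⟩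
  rw [← Set.inter_iUnion, Set.inter_eq_left.2 hsub]

theorem iUnion {ι : Type*} [Countable ι] {E : ι → Set G} (h : ∀ n, S.IsAronszajnUnion X (E n)) :
    S.IsAronszajnUnion X (⋃ n, E n) := by
  choose F hF hFX using h
  refine ⟨fun i => ⋃ n, F n i, ?_, fun i => AronszajnClass.iUnion fun n => hFX n i⟩
  rw [Set.iUnion_comm]
  exact Set.iUnion_congr hF

theorem of_mem {i : ℕ} {E : Set G} (h : E ∈ S.AronszajnClass (X i)) :
    S.IsAronszajnUnion X E := by
  classical
  refine ⟨fun j => if j = i then E else ∅, ?_, fun j => ?_⟩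
  · ext x
    simp
  · by_cases hj : j = i
    · subst hj; simpa using h
    · simpa [hj] using AronszajnClass.empty _

theorem empty : S.IsAronszajnUnion X ∅ := of_mem (i := 0) (AronszajnClass.empty _)

theorem union {E E' : Set G} (h : S.IsAronszajnUnion X E) (h' : S.IsAronszajnUnion X E') :
    S.IsAronszajnUnion X (E ∪ E') := by
  rw [Set.union_eq_iUnion]
  exact iUnion fun b => by cases b <;> assumption

/-- A set that is not an Aronszajn union, minus an Aronszajn union, is not covered by countably
many Aronszajn unions. -/
theorem exists_not {ι : Type*} [Countable ι] {B N : Set G} {E : ι → Set G} (hB : ¬ S.IsAronszajnUnion X B)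
    (hBm : MeasurableSet B) (hN : S.IsAronszajnUnion X N) (hE : ∀ x ∈ B, x ∉ N → ∃ n, x ∈ E n) :
    ∃ n, ¬ S.IsAronszajnUnion X (E n) := by
  by_contra! h
  exact hB ((hN.union (iUnion h)).mono hBm fun x hx => by
    by_cases hxN : x ∈ N
    · exact Or.inl hxN
    · exact Or.inr (Set.mem_iUnion.2 (hE x hx hxN)))

end IsAronszajnUnion

end Ideal

/-! ### Density theorem for convolutions of uniform laws on segments. -/

section Density

variable {G : Type*} [Group G] [TopologicalSpace G] [MeasurableSpace G] {S : ScalableStructure G}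
  {X : ℕ → G}

/-- Up to an Aronszajn union, all points of a Borel set are density points of it with respect to the
dilations of the measure `ν`. -/
def HasDensity (S : ScalableStructure G) (X : ℕ → G) (ν : Measure G) : Prop :=
  ∀ B : Set G, MeasurableSet B → ∃ N, S.IsAronszajnUnion X N ∧ ∀ x ∈ B, x ∉ N →
    Tendsto (fun n : ℕ => ν.map (S.dil ((n : ℝ) + 1)⁻¹) {y | x * y ∈ B}) atTop (𝓝 1)

omit [TopologicalSpace G] in
theorem measurable_measure_translate [MeasurableMul₂ G] (ν : Measure G) [SFinite ν] {B : Set G}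
    (hB : MeasurableSet B) : Measurable fun x => ν {y | x * y ∈ B} :=
  measurable_measure_prodMk_left (measurable_mul hB)

omit [TopologicalSpace G] in
theorem mconv_translate [MeasurableMul₂ G] (ν ν' : Measure G) [SFinite ν'] {B : Set G}
    (hB : MeasurableSet B) (x : G) :
    (ν.mconv ν') {z | x * z ∈ B} = ∫⁻ y, ν' {z | x * y * z ∈ B} ∂ν := by
  have hxB : MeasurableSet {y | x * y ∈ B} := measurable_const_mul x hB
  rw [Measure.mconv, Measure.map_apply measurable_mul hxB,
    Measure.prod_apply (measurable_mul hxB)]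
  refine lintegral_congr fun y => ?_
  congr 1
  ext z
  simp [mul_assoc]

omit [TopologicalSpace G] in
-- Condition on the first factor `y` and keep only the `y` with `x * y ∈ C`.
theorem mul_le_mconv_translate [MeasurableMul₂ G] (ν ν' : Measure G) [SFinite ν'] {B C : Set G}
    (hB : MeasurableSet B) (hC : MeasurableSet C) {c : ℝ≥0∞}
    (h : ∀ x ∈ C, c ≤ ν' {z | x * z ∈ B}) (x : G) :
    c * ν {y | x * y ∈ C} ≤ (ν.mconv ν') {z | x * z ∈ B} := by
  have hxC : MeasurableSet {y | x * y ∈ C} := measurable_const_mul x hC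
  rw [mconv_translate ν ν' hB, ← setLIntegral_const, ← lintegral_indicator hxC]
  refine lintegral_mono fun y => ?_
  by_cases hy : x * y ∈ C
  · rw [Set.indicator_of_mem (by exact hy)]
    exact h _ hy
  · rw [Set.indicator_of_notMem (by exact hy)]
    exact zero_le

theorem HasDensity.one [BorelSpace G] : S.HasDensity X (Measure.dirac 1) := by
  refine fun B hB => ⟨∅, .empty, fun x hx _ => ?_⟩
  have : ∀ n : ℕ, (Measure.dirac (1 : G)).map (S.dil ((n : ℝ) + 1)⁻¹) {y | x * y ∈ B} = 1 := by
    intro n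
    rw [Measure.map_dirac' (continuous_dil_right _).measurable, map_one]
    exact Measure.dirac_apply_of_mem (by simpa using hx)
  simp [this]

/-- Density is used twice: for `ν'` at points of `B`, then for `ν` at points of the countably many
sets `C (j, m)` where the first convergence is uniform. Dilations are homomorphisms, so they pass
through the convolution, which has mass at least `(1 - 1/(j+1))` times a quantity tending to `1`. -/
theorem HasDensity.mconv [BorelSpace G] [MeasurableMul₂ G] {ν ν' : Measure G}
    [IsProbabilityMeasure ν] [IsProbabilityMeasure ν'] (h : S.HasDensity X ν)
    (h' : S.HasDensity X ν') : S.HasDensity X (ν.mconv ν') := by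
  intro B hB
  have hdm : ∀ r, Measurable (S.dil r) := fun r => (continuous_dil_right r).measurable
  have hprob : ∀ (ν : Measure G) [IsProbabilityMeasure ν] (n : ℕ),
      IsProbabilityMeasure (ν.map (S.dil ((n : ℝ) + 1)⁻¹)) := fun ν _ n =>
    Measure.isProbabilityMeasure_map (hdm _).aemeasurable
  obtain ⟨N₀, hN₀, hlim₀⟩ := h' B hB
  let C : ℕ × ℕ → Set G := fun p => B ∩ ⋂ n ≥ p.2,
    {x | (1 : ℝ≥0∞) - (p.1 + 1 : ℝ≥0∞)⁻¹ ≤ ν'.map (S.dil ((n : ℝ) + 1)⁻¹) {y | x * y ∈ B}}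
  have hC : ∀ p, MeasurableSet (C p) := fun p => hB.inter <| .iInter fun n => .iInter fun _ =>
    measurableSet_le measurable_const (measurable_measure_translate _ hB)
  choose N hN hlim using fun p => h (C p) (hC p)
  refine ⟨N₀ ∪ ⋃ p, N p, hN₀.union (.iUnion hN), fun x hx hxN => ?_⟩
  rw [Set.mem_union, Set.mem_iUnion] at hxN
  push Not at hxN
  refine tendsto_order.2 ⟨fun a ha => ?_, fun a ha => Eventually.of_forall fun n =>
    lt_of_le_of_lt (prob_le_one (μ := (ν.mconv ν').map _)) ha⟩
  obtain ⟨j, hj⟩ : ∃ j : ℕ, a < 1 - (j + 1 : ℝ≥0∞)⁻¹ := by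
    have h1 : Tendsto (fun j : ℕ => (1 : ℝ≥0∞) - (j + 1 : ℝ≥0∞)⁻¹) atTop (𝓝 (1 - 0)) := by
      refine ENNReal.Tendsto.sub tendsto_const_nhds ?_ (Or.inl ENNReal.one_ne_top)
      have := (tendsto_add_atTop_iff_nat 1).2 ENNReal.tendsto_inv_nat_nhds_zero
      simpa using this
    rw [tsub_zero] at h1
    exact (h1.eventually (lt_mem_nhds ha)).exists
  have hxm : ∃ m, x ∈ C (j, m) := by
    have := (hlim₀ x hx hxN.1).eventually (lt_mem_nhds (show 1 - (j + 1 : ℝ≥0∞)⁻¹ < 1 from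
      ENNReal.sub_lt_self ENNReal.one_ne_top one_ne_zero (by simp)))
    obtain ⟨m, hm⟩ := eventually_atTop.1 this
    exact ⟨m, hx, Set.mem_iInter₂.2 fun n hn => (hm n hn).le⟩
  obtain ⟨m, hm⟩ := hxm
  have hlim2 := ENNReal.Tendsto.const_mul (a := 1 - (j + 1 : ℝ≥0∞)⁻¹)
    (hlim (j, m) x hm (hxN.2 (j, m))) (Or.inl one_ne_zero)
  rw [mul_one] at hlim2
  filter_upwards [hlim2.eventually (lt_mem_nhds hj), eventually_ge_atTop m] with n hn hnm
  refine hn.trans_le ?_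
  rw [Measure.map_mconv_monoidHom _ (hdm _)]
  exact mul_le_mconv_translate _ _ hB (hC (j, m))
    (fun y hy => Set.mem_iInter₂.1 hy.2 n hnm) x

theorem isProbabilityMeasure_lineMeasure [BorelSpace G] (Y : G) {a b : ℝ} (hab : a < b) :
    IsProbabilityMeasure (S.lineMeasure Y a b) := by
  have := isProbabilityMeasure_cond_Icc hab
  exact Measure.isProbabilityMeasure_map (continuous_dil_left Y).measurable.aemeasurable

theorem cond_Icc_preimage_affine {a b r s : ℝ} (hab : a < b) (hr : 0 < r) (T : Set ℝ) :
    ProbabilityTheory.cond volume (Set.Icc a b) {t | s + r * t ∈ T} =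
      volume (T ∩ Metric.closedBall (s + r * ((a + b) / 2)) (r * ((b - a) / 2))) /
        volume (Metric.closedBall (s + r * ((a + b) / 2)) (r * ((b - a) / 2))) := by
  rw [ProbabilityTheory.cond_apply measurableSet_Icc]
  have hset : Set.Icc a b ∩ {t | s + r * t ∈ T} = (r * ·) ⁻¹' ((s + ·) ⁻¹'
      (T ∩ Metric.closedBall (s + r * ((a + b) / 2)) (r * ((b - a) / 2)))) := by
    ext t
    simp only [Set.mem_inter_iff, Set.mem_Icc, Set.mem_ofPred_eq, Set.mem_preimage,
      Real.closedBall_eq_Icc]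
    rw [and_comm]
    refine and_congr_right fun _ => and_congr ?_ ?_
    · rw [← mul_le_mul_iff_right₀ hr]
      constructor <;> intro h <;> linarith
    · rw [← mul_le_mul_iff_right₀ hr]
      constructor <;> intro h <;> linarith
  rw [hset, Real.volume_preimage_mul_left hr.ne', measure_preimage_add, Real.volume_closedBall,
    Real.volume_Icc, ENNReal.div_eq_inv_mul, ← mul_assoc]
  congr 1
  rw [abs_of_pos (inv_pos.2 hr), show 2 * (r * ((b - a) / 2)) = (b - a) * r by ring,
    ENNReal.ofReal_mul (by linarith), ENNReal.mul_inv (Or.inr ENNReal.ofReal_ne_top)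
    (Or.inr (by simpa using hr)), ENNReal.ofReal_inv_of_pos hr]

/-- The exceptional points of `B` are in `𝒜(X i)` by Lebesgue's density theorem on each coset of the
line of `X i`. -/
theorem HasDensity.lineMeasure [IsTopologicalGroup G] [BorelSpace G] [MeasurableMul₂ G] {i : ℕ} {a b : ℝ}
    (hab : a < b) (hX : X i ∈ S.firstLayer) : S.HasDensity X (S.lineMeasure (X i) a b) := by
  intro B hB
  have hprob := isProbabilityMeasure_lineMeasure (S := S) (X i) hab
  have hdm : ∀ r, Measurable (S.dil r) := fun r => (continuous_dil_right r).measurable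
  have hlm := (continuous_dil_left (S := S) (X i)).measurable
  have hprob : ∀ (n : ℕ), IsProbabilityMeasure ((S.lineMeasure (X i) a b).map
      (S.dil ((n : ℝ) + 1)⁻¹)) := fun n => Measure.isProbabilityMeasure_map (hdm _).aemeasurable
  set Q := {x | Tendsto (fun n : ℕ => (S.lineMeasure (X i) a b).map (S.dil ((n : ℝ) + 1)⁻¹)
    {y | x * y ∈ B}) atTop (𝓝 1)} with hQ
  have hQm : MeasurableSet Q := measurableSet_tendsto _ fun n => measurable_measure_translate _ hB
  refine ⟨B \ Q, .of_mem (i := i) ⟨hB.diff hQm, fun g => ?_⟩, fun x hx hxQ => ?_⟩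
  swap
  · by_contra h
    exact hxQ ⟨hx, h⟩
  set T := {t : ℝ | g * S.dil t (X i) ∈ B} 
  have hTm : MeasurableSet T := (measurable_const_mul g).comp hlm hB
  -- The shrinking intervals `s + r[a, b]` need not contain `s`, but the distance of their centre
  -- from `s` is `|a + b| / (b - a)` times their radius. The density theorem allows a bounded ratio.
  have hdens := IsUnifLocDoublingMeasure.ae_tendsto_measure_inter_div (volume : Measure ℝ) T
    (|a + b| / (b - a))
  rw [ae_restrict_iff' hTm] at hdens
  refine measure_mono_null ?_ hdens
  rintro s ⟨hsB, hsQ⟩ hs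
  refine hsQ ?_
  have hr : ∀ n : ℕ, 0 < ((n : ℝ) + 1)⁻¹ := fun n => by positivity
  have hconv : Tendsto (fun n : ℕ => ((n : ℝ) + 1)⁻¹ * ((b - a) / 2)) atTop (𝓝[>] 0) := by
    refine tendsto_nhdsWithin_iff.2 ⟨?_, Eventually.of_forall fun n => ?_⟩
    · have := (tendsto_one_div_add_atTop_nhds_zero_nat (𝕜 := ℝ)).mul_const ((b - a) / 2)
      simpa using this
    · exact mul_pos (hr n) (by linarith)
  have key := hs hsB (fun n : ℕ => s + ((n : ℝ) + 1)⁻¹ * ((a + b) / 2)) _ hconv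
    (Eventually.of_forall fun n => by
      rw [Metric.mem_closedBall, dist_self_add_right, Real.norm_eq_abs, abs_mul, abs_of_pos (hr n),
        abs_div, abs_two]
      have : b - a ≠ 0 := by linarith
      apply le_of_eq
      field_simp)
  refine key.congr fun n => ?_
  have hBs : MeasurableSet {y | g * S.dil s (X i) * y ∈ B} := measurable_const_mul _ hB
  rw [← cond_Icc_preimage_affine hab (hr n) T, Measure.map_apply (hdm _) hBs,
    ScalableStructure.lineMeasure, Measure.map_apply hlm (hdm _ hBs)]
  congr 1
  ext t
  change g * S.dil (s + ((n : ℝ) + 1)⁻¹ * t) (X i) ∈ B ↔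
    g * S.dil s (X i) * S.dil ((n : ℝ) + 1)⁻¹ (S.dil t (X i)) ∈ B
  rw [hX, S.dil_dil, mul_assoc]

theorem IsLineConv.isProbabilityMeasure [BorelSpace G] [MeasurableMul₂ G] {A : Set G}
    {ν : Measure G} (h : S.IsLineConv A ν) : IsProbabilityMeasure ν := by
  induction h with
  | one => infer_instance
  | mul Y hY a b hab _ ih =>
    have := isProbabilityMeasure_lineMeasure (S := S) Y hab
    infer_instance

theorem IsLineConv.hasDensity [IsTopologicalGroup G] [BorelSpace G] [MeasurableMul₂ G]
    {A : Set G} (hA : A ⊆ Set.range X)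
    (hX : ∀ i, X i ∈ S.firstLayer) {ν : Measure G} (h : S.IsLineConv A ν) : S.HasDensity X ν := by
  induction h with
  | one => exact .one
  | mul Y hY a b hab hν ih =>
    obtain ⟨i, rfl⟩ := hA hY
    have := isProbabilityMeasure_lineMeasure (S := S) (X i) hab
    have := hν.isProbabilityMeasure
    exact (HasDensity.lineMeasure hab (hX i)).mconv ih

theorem IsLineConv.exists_isCompact [IsTopologicalGroup G] [BorelSpace G] [T2Space G]
    [MeasurableMul₂ G] {A : Set G}
    {ν : Measure G} (h : S.IsLineConv A ν) : ∃ K : Set G, IsCompact K ∧ ν Kᶜ = 0 := by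
  induction h with
  | one => exact ⟨{1}, isCompact_singleton, by rw [Measure.dirac_apply' _ (by measurability)]; simp⟩
  | @mul ν Y hY a b hab hν ih =>
    obtain ⟨K, hK, hK0⟩ := ih
    have := isProbabilityMeasure_lineMeasure (S := S) Y hab
    have := hν.isProbabilityMeasure
    have hlm := (continuous_dil_left (S := S) Y)
    have hKI : IsCompact ((fun t => S.dil t Y) '' Set.Icc a b) := isCompact_Icc.image hlm
    open Pointwise in
    refine ⟨(fun t => S.dil t Y) '' Set.Icc a b * K, hKI.mul hK, ?_⟩
    have hI0 : S.lineMeasure Y a b ((fun t => S.dil t Y) '' Set.Icc a b)ᶜ = 0 := by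
      rw [ScalableStructure.lineMeasure, Measure.map_apply hlm.measurable hKI.measurableSet.compl]
      refine measure_mono_null (t := (Set.Icc a b)ᶜ) (fun t ht htI => ht ⟨t, htI, rfl⟩) ?_
      rw [ProbabilityTheory.cond_apply measurableSet_Icc]
      simp
    rw [Measure.mconv, Measure.map_apply measurable_mul (hKI.mul hK).measurableSet.compl]
    refine measure_mono_null (t := (((fun t => S.dil t Y) '' Set.Icc a b)ᶜ ×ˢ Set.univ) ∪
      (Set.univ ×ˢ Kᶜ)) ?_ ?_
    · rintro ⟨x, y⟩ hxy
      by_contra hcon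
      simp only [Set.mem_union, Set.mem_prod, Set.mem_compl_iff, Set.mem_univ, and_true, true_and,
        not_or, not_not] at hcon
      exact hxy (Set.mul_mem_mul hcon.1 hcon.2)
    · rw [measure_union_null_iff, Measure.prod_prod, Measure.prod_prod, hI0, hK0]
      simp

end Density

/-- Absolutely continuous measures on a scalable subgroup stay absolutely continuous under
dilations. -/
theorem ACMeasures_map_dil {G : Type*} [Group G] [TopologicalSpace G] [IsTopologicalGroup G]
    [MeasurableSpace G] [BorelSpace G] {S : ScalableStructure G} {H : Subgroup G}
    (hH : S.IsScalableSubgroup H) {ν : Measure G} (hν : ν ∈ ACMeasures H) {r : ℝ} (hr : r ≠ 0) :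
    ν.map (S.dil r) ∈ ACMeasures H := by
  obtain ⟨vol, ν', hvol, hν', hac, rfl⟩ := hν
  have hmem : ∀ s : ℝ, s ≠ 0 → ∀ h : H, S.dil s h ∈ H := fun s hs h =>
    (hH.2 s hs).le ⟨h, h.2, rfl⟩
  have hinv : ∀ s : ℝ, s ≠ 0 → ∀ g : G, S.dil s⁻¹ (S.dil s g) = g := fun s hs g => by
    rw [S.dil_dil, inv_mul_cancel₀ hs, dil_one]
  let D : H ≃* H :=
    { toFun := fun h => ⟨S.dil r h, hmem r hr h⟩
      invFun := fun h => ⟨S.dil r⁻¹ h, hmem _ (inv_ne_zero hr) h⟩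
      left_inv := fun h => Subtype.ext (hinv r hr h)
      right_inv := fun h => Subtype.ext (by
        have := hinv r⁻¹ (inv_ne_zero hr) (h : G)
        rwa [inv_inv] at this)
      map_mul' := fun h h' => Subtype.ext (by simp) }
  have hD : Continuous D :=
    ((continuous_dil_right r).comp continuous_subtype_val).subtype_mk _
  have hD' : Continuous D.symm :=
    ((continuous_dil_right r⁻¹).comp continuous_subtype_val).subtype_mk _
  refine ⟨vol.map D, ν'.map D, D.isHaarMeasure_map vol hD hD',
    Measure.isProbabilityMeasure_map hD.measurable.aemeasurable, hac.map hD.measurable, ?_⟩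
  rw [Measure.map_map (continuous_dil_right r).measurable measurable_subtype_coe,
    Measure.map_map measurable_subtype_coe hD.measurable]
  rfl

end ScalableStructure

/-! ### Covers of a Polish space that control limits inside a Borel set. -/

section Scheme

/-- A Polish space is covered, for every `k`, by finite unions of small closed sets in such a way
that the sequences that stay in these finite unions have convergent subsequences. -/
theorem exists_closed_covers {Y : Type*} [TopologicalSpace Y] [PolishSpace Y] :
    ∃ C : ℕ → ℕ → Set Y, (∀ k n, IsClosed (C k n)) ∧ (∀ k, Monotone (C k)) ∧
      (∀ k, ⋃ n, C k n = Set.univ) ∧ ∀ (N : ℕ → ℕ) (y : ℕ → Y), (∀ j, ∀ k < j, y j ∈ C k (N k)) →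
        ∃ x, ∃ φ : ℕ → ℕ, StrictMono φ ∧ Tendsto (y ∘ φ) atTop (𝓝 x) := by
  let := TopologicalSpace.upgradeIsCompletelyMetrizable Y
  rcases isEmpty_or_nonempty Y with hY | hY
  · exact ⟨fun _ _ => ∅, fun _ _ => isClosed_empty, fun _ _ _ _ => le_rfl,
      fun _ => Set.eq_univ_of_forall fun x => (hY.false x).elim, fun N y => (hY.false (y 0)).elim⟩
  let u := TopologicalSpace.denseSeq Y
  refine ⟨fun k n => ⋃ i ∈ Set.Iic n, Metric.closedBall (u i) ((k : ℝ) + 1)⁻¹, fun k n => ?_,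
    fun k n m hnm => ?_, fun k => ?_, fun N y hy => ?_⟩
  · exact (Set.finite_Iic n).isClosed_biUnion fun i _ => Metric.isClosed_closedBall
  · exact Set.biUnion_subset_biUnion_left (Set.Iic_subset_Iic.2 hnm)
  · refine Set.eq_univ_of_forall fun x => ?_
    obtain ⟨i, hi⟩ := (TopologicalSpace.denseRange_denseSeq Y).exists_dist_lt x
      (show (0 : ℝ) < ((k : ℝ) + 1)⁻¹ by positivity)
    exact Set.mem_iUnion.2 ⟨i, Set.mem_iUnion₂.2 ⟨i, Set.mem_Iic.2 le_rfl, hi.le⟩⟩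
  -- At scale `k` all terms of index above `k` lie in finitely many small balls, and the remaining
  -- terms are finitely many.
  · have htb : TotallyBounded (Set.range y) := by
      refine Metric.totallyBounded_iff.2 fun δ hδ => ?_
      obtain ⟨k, hk⟩ := exists_nat_one_div_lt hδ
      refine ⟨u '' Set.Iic (N k) ∪ y '' Set.Iic k, ((Set.finite_Iic _).image _).union
        ((Set.finite_Iic _).image _), ?_⟩
      rintro _ ⟨j, rfl⟩
      rcases le_or_gt j k with hjk | hjk
      · exact Set.mem_iUnion₂.2 ⟨y j, Or.inr ⟨j, hjk, rfl⟩, Metric.mem_ball_self hδ⟩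
      · obtain ⟨i, hi, hij⟩ := Set.mem_iUnion₂.1 (hy j k hjk)
        refine Set.mem_iUnion₂.2 ⟨u i, Or.inl ⟨i, hi, rfl⟩, ?_⟩
        rw [one_div] at hk
        exact lt_of_le_of_lt hij hk
    obtain ⟨x, -, φ, hφ, hlim⟩ := (htb.closure.isCompact_of_isClosed isClosed_closure).tendsto_subseq
      (fun j => subset_closure (Set.mem_range_self j))
    exact ⟨x, φ, hφ, hlim⟩

/-- The covers are taken in the Polish space `Z`, where `E` is closed. Lusin-Souslin makes their
images Borel. A sequence frequently meeting the conditions has a subsequence whose lift converges in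
`Z`, necessarily inside `E`, and its image is the given limit. -/
theorem exists_covers_of_bijective {Z Y : Type*} [TopologicalSpace Z] [PolishSpace Z]
    [TopologicalSpace Y] [T2Space Y] [SecondCountableTopology Y] [MeasurableSpace Y] [BorelSpace Y]
    {π : Z → Y} (hπ : Continuous π) (hbij : Function.Bijective π) {E : Set Z} (hE : IsClosed E) :
    ∃ C : ℕ → ℕ → Set Y, (∀ k n, MeasurableSet (C k n)) ∧ (∀ k, Monotone (C k)) ∧
      (∀ k, ⋃ n, C k n = Set.univ) ∧ ∀ (N : ℕ → ℕ) (y : ℕ → Y) (x : Y), Tendsto y atTop (𝓝 x) →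
        (∃ᶠ j in atTop, y j ∈ π '' E ∧ ∀ k < j, y j ∈ C k (N k)) → x ∈ π '' E := by
  obtain ⟨C, hC, hmono, hcov, hlim⟩ := exists_closed_covers (Y := Z)
  refine ⟨fun k n => π '' C k n, fun k n =>
    (hC k n).measurableSet_image_of_continuousOn_injOn hπ.continuousOn hbij.1.injOn,
    fun k n m hnm => Set.image_mono (hmono k hnm), fun k => ?_, fun N y x hyx hfreq => ?_⟩
  · rw [← Set.image_iUnion, hcov, Set.image_univ, hbij.2.range_eq]
  · obtain ⟨φ, hφ, hφE⟩ := extraction_of_frequently_atTop hfreq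
    choose z hz using fun j => hbij.2 (y (φ j))
    have hzmem : ∀ j s, y (φ j) ∈ π '' s → z j ∈ s := by
      rintro j s ⟨w, hw, hwy⟩
      rwa [← hbij.1 (hwy.trans (hz j).symm)]
    obtain ⟨a, ψ, hψ, ha⟩ := hlim N z fun j k hkj =>
      hzmem j _ ((hφE j).2 k (hkj.trans_le (hφ.id_le j)))
    have h1 : Tendsto (fun j => y (φ (ψ j))) atTop (𝓝 (π a)) := by
      have := (hπ.tendsto a).comp ha
      refine this.congr fun j => hz (ψ j)
    rw [tendsto_nhds_unique (hyx.comp (hφ.tendsto_atTop.comp hψ.tendsto_atTop)) h1]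
    exact ⟨a, hE.mem_of_tendsto ha (Eventually.of_forall fun j => hzmem _ _ (hφE (ψ j)).1), rfl⟩

/-- The covers of a Polish space by Borel sets that allow one to pass to limits within a given Borel
set. -/
theorem MeasurableSet.exists_covers {Y : Type*} [t : TopologicalSpace Y] [PolishSpace Y]
    [MeasurableSpace Y] [BorelSpace Y] {E : Set Y} (hE : MeasurableSet E) :
    ∃ C : ℕ → ℕ → Set Y, (∀ k n, MeasurableSet (C k n)) ∧ (∀ k, Monotone (C k)) ∧
      (∀ k, ⋃ n, C k n = Set.univ) ∧ ∀ (N : ℕ → ℕ) (y : ℕ → Y) (x : Y), Tendsto y atTop (𝓝 x) →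
        (∃ᶠ j in atTop, y j ∈ E ∧ ∀ k < j, y j ∈ C k (N k)) → x ∈ E := by
  -- A Borel set is clopen in a finer Polish topology; the previous result applies to the identity
  -- map from it.
  have h : ∃ t' : TopologicalSpace Y, t' ≤ t ∧ @PolishSpace Y t' ∧ IsClosed[t'] E ∧ IsOpen[t'] E :=
    hE.isClopenable
  have := @exists_covers_of_bijective Y Y h.choose h.choose_spec.2.1 t _ _ _ _ id
    (continuous_id_of_le h.choose_spec.1) Function.bijective_id E h.choose_spec.2.2.1
  rwa [Set.image_id] at this

end Scheme

/-! ### Infinite convolutions as laws of random products. -/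

section RandomProduct

/-- The product `ω (m + n) ⋯ ω (m + 1) ω m`. -/
def partialProd {G : Type*} [Mul G] (ω : ℕ → G) (m : ℕ) : ℕ → G
  | 0 => ω m
  | n + 1 => ω (m + (n + 1)) * partialProd ω m n

variable {G : Type*} [Group G] [MeasurableSpace G]

theorem measurable_partialProd_of [MeasurableMul₂ G] {m0 : MeasurableSpace (ℕ → G)} (m n : ℕ)
    (h : ∀ i ≤ m + n, Measurable[m0] fun ω : ℕ → G => ω i) :
    Measurable[m0] fun ω : ℕ → G => partialProd ω m n := by
  induction n with
  | zero => exact h m le_rfl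
  | succ n ih =>
    exact (h _ le_rfl).mul (ih fun i hi => h i (by omega))

theorem measurable_partialProd [MeasurableMul₂ G] (m n : ℕ) :
    Measurable fun ω : ℕ → G => partialProd ω m n :=
  measurable_partialProd_of m n fun i _ => measurable_pi_apply i

/-- Convolutions are the laws of products of independent random elements. -/
theorem map_partialProd_infinitePi [MeasurableMul₂ G] (ν : ℕ → Measure G)
    [∀ k, IsProbabilityMeasure (ν k)] (m n : ℕ) :
    (Measure.infinitePi ν).map (fun ω => partialProd ω m n) = convProd ν m n := by
  have hev : ∀ k, (Measure.infinitePi ν).map (fun ω : ℕ → G => ω k) = ν k := fun k =>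
    (measurePreserving_eval_infinitePi ν k).map_eq
  induction n with
  | zero => exact hev m
  | succ n ih =>
    have hind : ProbabilityTheory.IndepFun (fun ω : ℕ → G => ω (m + (n + 1)))
        (fun ω => partialProd ω m n) (Measure.infinitePi ν) := by
      have h1 := ProbabilityTheory.iIndepFun_infinitePi (P := ν) (X := fun _ (x : G) => x)
        (fun _ => measurable_id)
      have h2 := ProbabilityTheory.indep_iSup_of_disjoint
        (m := fun i => MeasurableSpace.comap (fun ω : ℕ → G => ω i) inferInstance)
        (fun i => (measurable_pi_apply i).comap_le) h1 (S := {m + (n + 1)}) (T := Set.Iic (m + n))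
        (by rw [Set.disjoint_singleton_left]; simp)
      rw [ProbabilityTheory.IndepFun_iff_Indep]
      refine ProbabilityTheory.indep_of_indep_of_le_left
        (ProbabilityTheory.indep_of_indep_of_le_right h2 ?_) ?_
      · refine (measurable_partialProd_of m n fun i hi => ?_).comap_le
        rw [measurable_iff_comap_le]
        exact le_iSup₂_of_le i hi le_rfl
      · exact le_iSup₂_of_le (m + (n + 1)) rfl le_rfl
    have := hind.map_mul_eq_map_mconv_map (measurable_pi_apply _) (measurable_partialProd m n)
    rw [hev, ih] at this
    exact this

variable [MetricSpace G]

omit [MeasurableSpace G] in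
/-- Deterministic criterion for the convergence of `ω n ⋯ ω m`. -/
theorem exists_tendsto_partialProd [CompleteSpace G] {ω : ℕ → G} {s K : ℕ → Set G}
    (h1 : ∀ k, 1 ∈ K k) (hK : ∀ k, ∀ y ∈ s k, ∀ z ∈ K k, y * z ∈ K (k + 1))
    (hdist : ∀ k, ∀ y ∈ s k, ∀ z ∈ K k, dist (y * z) z ≤ (1 / 2) ^ k) (hω : ∀ k, ω k ∈ s k) (m : ℕ) :
    ∃ l, Tendsto (partialProd ω m) atTop (𝓝 l) := by
  -- Since `1` belongs to every `K m`, a product may start at any index, so a single chain of sets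
  -- serves all `m`.
  have hmem : ∀ n, partialProd ω m n ∈ K (m + n + 1) := by
    intro n
    induction n with
    | zero => simpa [partialProd] using hK m _ (hω m) 1 (h1 m)
    | succ n ih => exact hK _ _ (hω _) _ ih
  refine cauchySeq_tendsto_of_complete (cauchySeq_of_le_geometric (1 / 2) 1 (by norm_num) fun n => ?_)
  rw [dist_comm, one_mul]
  refine (hdist (m + (n + 1)) _ (hω _) _ (hmem n)).trans ?_
  exact pow_le_pow_of_le_one (by norm_num) (by norm_num) (by omega)

/-- Convergent random products give weakly convergent convolutions. -/
theorem exists_limit_convProd [CompleteSpace G] [BorelSpace G] [MeasurableMul₂ G]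
    (ν : ℕ → Measure G) [∀ k, IsProbabilityMeasure (ν k)] {s K : ℕ → Set G}
    (h1 : ∀ k, 1 ∈ K k) (hK : ∀ k, ∀ y ∈ s k, ∀ z ∈ K k, y * z ∈ K (k + 1))
    (hdist : ∀ k, ∀ y ∈ s k, ∀ z ∈ K k, dist (y * z) z ≤ (1 / 2) ^ k)
    (hs : ∀ k, ν k (s k)ᶜ = 0) :
    ∃ Z : ℕ → (ℕ → G) → G, (∀ m, Measurable (Z m)) ∧
      (∀ m, ∀ᵐ ω ∂(Measure.infinitePi ν), Tendsto (partialProd ω m) atTop (𝓝 (Z m ω))) ∧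
      ∀ m, ∃ η : ProbabilityMeasure G, (η : Measure G) = (Measure.infinitePi ν).map (Z m) ∧
        TendstoWeakly (convProd ν m) η := by
  have hae : ∀ᵐ ω ∂(Measure.infinitePi ν), ∀ k, ω k ∈ s k := by
    rw [ae_all_iff]
    intro k
    have := (measurePreserving_eval_infinitePi ν k).quasiMeasurePreserving.ae
      (p := fun x => x ∈ s k) (by rw [ae_iff]; exact hs k)
    exact this
  choose Z hZ hlim using fun m => measurable_limit_of_tendsto_metrizable_ae
    (μ := Measure.infinitePi ν) (f := fun n ω => partialProd ω m n) (L := atTop)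
    (fun n => (measurable_partialProd m n).aemeasurable)
    (hae.mono fun ω hω => exists_tendsto_partialProd h1 hK hdist hω m)
  refine ⟨Z, hZ, hlim, fun m => ?_⟩
  have hp : ∀ n, IsProbabilityMeasure (convProd ν m n) := fun n => by
    rw [← map_partialProd_infinitePi]
    exact Measure.isProbabilityMeasure_map (measurable_partialProd m n).aemeasurable
  let η : ProbabilityMeasure G :=
    ⟨(Measure.infinitePi ν).map (Z m), Measure.isProbabilityMeasure_map (hZ m).aemeasurable⟩
  let p : ℕ → ProbabilityMeasure G := fun n => ⟨convProd ν m n, hp n⟩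
  refine ⟨η, rfl, p, fun n => rfl, ?_⟩
  rw [ProbabilityMeasure.tendsto_iff_forall_integral_tendsto]
  intro f
  simp only [η, p, ProbabilityMeasure.coe_mk, ← map_partialProd_infinitePi]
  rw [integral_map (hZ m).aemeasurable f.continuous.measurable.aestronglyMeasurable]
  simp_rw [fun n => integral_map (measurable_partialProd (G := G) m n).aemeasurable
    (μ := Measure.infinitePi ν) (f := f) f.continuous.measurable.aestronglyMeasurable]
  refine tendsto_integral_of_dominated_convergence (fun _ => ‖f‖)
    (fun n => (f.continuous.measurable.comp (measurable_partialProd m n)).aestronglyMeasurable)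
    (integrable_const _) (fun n => Eventually.of_forall fun ω => f.norm_coe_le_norm _) ?_
  filter_upwards [hlim m] with ω hω
  exact (f.continuous.tendsto _).comp hω

end RandomProduct

/-- Events of probability at least `c` happen infinitely often with probability at least `c`. -/
theorem le_measure_frequently {Ω : Type*} [MeasurableSpace Ω] (P : Measure Ω) [IsFiniteMeasure P]
    {D : ℕ → Set Ω} (hD : ∀ n, MeasurableSet (D n)) {c : ℝ≥0∞} (h : ∀ n, c ≤ P (D n)) :
    c ≤ P {ω | ∃ᶠ n in atTop, ω ∈ D n} := by
  have hset : {ω | ∃ᶠ n in atTop, ω ∈ D n} = ⋂ n, ⋃ k ≥ n, D k := by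
    ext ω
    simp [frequently_atTop]
  rw [hset]
  refine ge_of_tendsto' (tendsto_measure_iInter_atTop
    (fun n => (MeasurableSet.iUnion fun k => .iUnion fun _ => hD k).nullMeasurableSet)
    (fun n m hnm => Set.biUnion_subset_biUnion_left fun k hk => le_trans hnm hk)
    ⟨0, measure_ne_top _ _⟩) fun n => (h n).trans (measure_mono ?_)
  exact Set.subset_biUnion_of_mem (u := D) (show n ≥ n from le_rfl)

/-! ### Construction of a CAC measure charging a given Borel set. -/

namespace ScalableStructure

variable {G : Type*} [Group G] [MetricSpace G] [IsTopologicalGroup G] [MeasurableSpace G]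
  [BorelSpace G] [SecondCountableTopology G] {S : ScalableStructure G} {X : ℕ → G}

/-- One step of the construction of a measure that charges a set that is not an Aronszajn union. -/
theorem exists_next_measure (hdil : ∀ (t : ℝ) (p q : G), dist (S.dil t p) (S.dil t q) = |t| * dist p q)
    (hX : S.IsCarnotSpanning X) (k : ℕ) {A B K : Set G} {ρ : Measure G} [IsProbabilityMeasure ρ]
    (hA : MeasurableSet A) (hB : MeasurableSet B) (hBX : ¬ S.IsAronszajnUnion X B)
    (hK : IsCompact K) {c c' : ℝ≥0∞} (hcc : c' < c) (hc : ∀ x ∈ B, c < ρ {y | x * y ∈ A})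
    {C : ℕ → Set G} (hC : ∀ n, MeasurableSet (C n)) (hCm : Monotone C)
    (hCu : ⋃ n, C n = Set.univ) {δ : ℝ} (hδ : 0 < δ) :
    ∃ (ν : Measure G) (s : Set G) (N : ℕ) (B' : Set G), ν ∈ ACMeasures (S.assocFiltration X k) ∧
      IsProbabilityMeasure ν ∧ IsCompact s ∧ ν sᶜ = 0 ∧
      (∀ y ∈ s, ∀ z ∈ K, dist (y * z) z ≤ δ) ∧ B' ⊆ B ∧ MeasurableSet B' ∧
      ¬ S.IsAronszajnUnion X B' ∧ (∀ x ∈ B', c' < (ν.mconv ρ) {y | x * y ∈ A ∩ C N}) ∧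
      ∀ x ∈ B', ∀ y ∈ B', dist x y ≤ δ := by
  have hdm : ∀ r, Measurable (S.dil r) := fun r => (continuous_dil_right r).measurable
  have hcarnot : S.IsCarnotSubgroup (S.generated {g | ∃ j ≤ k, g = X j}) := hX.2.1 k
  obtain ⟨ν₀, hν₀, hac⟩ := hcarnot.exists_isLineConv_mem_acMeasures (by
    rintro _ ⟨j, -, rfl⟩
    exact hX.1 j)
  have hν₀p := hν₀.isProbabilityMeasure
  have hdens := hν₀.hasDensity (X := X) (by rintro _ ⟨j, -, rfl⟩; exact ⟨j, rfl⟩) hX.1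
  obtain ⟨K₁, hK₁, hνK₁⟩ := hν₀.exists_isCompact
  obtain ⟨N₀, hN₀, hlim⟩ := hdens B hB
  have hp : ∀ n : ℕ, IsProbabilityMeasure (ν₀.map (S.dil ((n : ℝ) + 1)⁻¹)) := fun n =>
    Measure.isProbabilityMeasure_map (hdm _).aemeasurable
  obtain ⟨e, he1, hce⟩ : ∃ e : ℝ≥0∞, e < 1 ∧ c' < c * e := by
    rcases B.eq_empty_or_nonempty with rfl | ⟨x, hx⟩
    · exact absurd .empty hBX
    have hctop : c ≠ ∞ := ((hc x hx).trans_le le_top).ne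
    have h1 : Tendsto (fun e : ℝ≥0∞ => c * e) (𝓝[<] 1) (𝓝 (c * 1)) :=
      (ENNReal.Tendsto.const_mul tendsto_id (Or.inl one_ne_zero)).mono_left nhdsWithin_le_nhds
    rw [mul_one] at h1
    have : (𝓝[<] (1 : ℝ≥0∞)).NeBot := nhdsLT_neBot_of_exists_lt ⟨0, one_pos⟩
    obtain ⟨e, h2, h3⟩ := ((h1.eventually (lt_mem_nhds hcc)).and self_mem_nhdsWithin).exists
    exact ⟨e, h3, h2⟩
  -- Makes the density statement uniform in the contraction, so that `n` can later be chosen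
  -- independently of the base point.
  let Em : ℕ → Set G := fun m => B ∩ ⋂ n ≥ m,
    {x | e ≤ ν₀.map (S.dil ((n : ℝ) + 1)⁻¹) {y | x * y ∈ B}}
  have hEm : ∀ m, MeasurableSet (Em m) := fun m => hB.inter <| .iInter fun n => .iInter fun _ =>
    measurableSet_le measurable_const (measurable_measure_translate _ hB)
  obtain ⟨m, hm⟩ := IsAronszajnUnion.exists_not hBX hB hN₀ (E := Em) fun x hx hxN => by
    obtain ⟨m, hm⟩ := eventually_atTop.1 ((hlim x hx hxN).eventually (lt_mem_nhds he1))
    exact ⟨m, hx, Set.mem_iInter₂.2 fun n hn => (hm n hn).le⟩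
  -- The new factor multiplies on the left, so its displacement of `z` is controlled uniformly only
  -- for `z` in a compact set.
  have hnear : ∀ᶠ y in 𝓝 (1 : G), ∀ z ∈ K, dist (y * z) z < δ := by
    refine hK.eventually_forall_of_forall_eventually fun z _ => ?_
    have hcont : Continuous fun p : G × G => dist (p.1 * p.2) p.2 := by fun_prop
    exact hcont.continuousAt.eventually_lt continuousAt_const (by simpa using hδ)
  obtain ⟨r, hr, hrδ⟩ := Metric.eventually_nhds_iff.1 hnear
  obtain ⟨R, hR⟩ := hK₁.isBounded.subset_closedBall 1
  obtain ⟨n, hn, hnm⟩ : ∃ n : ℕ, ((n : ℝ) + 1)⁻¹ * R < r ∧ m ≤ n := by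
    have h1 := (tendsto_one_div_add_atTop_nhds_zero_nat (𝕜 := ℝ)).mul_const R
    rw [zero_mul] at h1
    obtain ⟨n, h2, h3⟩ := ((h1.eventually (gt_mem_nhds hr)).and (eventually_ge_atTop m)).exists
    exact ⟨n, by simpa using h2, h3⟩
  have hn0 : (0 : ℝ) < ((n : ℝ) + 1)⁻¹ := by positivity
  set ν := ν₀.map (S.dil ((n : ℝ) + 1)⁻¹) with hν
  have hsc : IsCompact (S.dil ((n : ℝ) + 1)⁻¹ '' K₁) := hK₁.image (continuous_dil_right _)
  -- With `ν`-mass at least `e` the point `x * y` stays in `B`, where `ρ` gives more than `c`; the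
  -- choice of `e` makes `c * e > c'`.
  have hνρ : ∀ x ∈ Em m, c' < (ν.mconv ρ) {y | x * y ∈ A} := fun x hx => by
    refine hce.trans_le (le_trans ?_ (mul_le_mconv_translate ν ρ hA hB (fun x hx => (hc x hx).le) x))
    exact mul_le_mul_right (Set.mem_iInter₂.1 hx.2 n hnm) c
  have : Nonempty G := ⟨1⟩
  let u := TopologicalSpace.denseSeq G
  -- The strict bound survives intersecting `A` with a large `C N`. Countably many pairs of `N` and
  -- a small ball cover `Em m`, so one piece is still not a union.
  let Bn : ℕ × ℕ → Set G := fun p => (Em m ∩ {x | c' < (ν.mconv ρ) {y | x * y ∈ A ∩ C p.1}}) ∩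
    Metric.closedBall (u p.2) (δ / 2)
  have hBn : ∀ p, MeasurableSet (Bn p) := fun p => ((hEm m).inter (measurableSet_lt measurable_const
    (measurable_measure_translate _ (hA.inter (hC _))))).inter measurableSet_closedBall
  obtain ⟨p, hp'⟩ := IsAronszajnUnion.exists_not hm (hEm m) .empty (E := Bn) fun x hx _ => by
    have hun : {y | x * y ∈ A} = ⋃ n, {y | x * y ∈ A ∩ C n} := by
      ext y
      have : x * y ∈ ⋃ n, C n := by rw [hCu]; trivial
      simp only [Set.mem_ofPred_eq, Set.mem_inter_iff, Set.mem_iUnion, exists_and_left]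
      exact ⟨fun h => ⟨h, Set.mem_iUnion.1 this⟩, fun h => h.1⟩
    have hmono : Monotone fun n => {y | x * y ∈ A ∩ C n} := fun i j hij y hy =>
      ⟨hy.1, hCm hij hy.2⟩
    have ht := tendsto_measure_iUnion_atTop (μ := ν.mconv ρ) hmono
    rw [← hun] at ht
    obtain ⟨N, hN⟩ := (ht.eventually (lt_mem_nhds (hνρ x hx))).exists
    obtain ⟨i, hi⟩ := (TopologicalSpace.denseRange_denseSeq G).exists_dist_lt x (half_pos hδ)
    exact ⟨(N, i), ⟨hx, hN⟩, hi.le⟩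
  refine ⟨ν, _, p.1, Bn p, ACMeasures_map_dil hcarnot.1 hac hn0.ne', hp n, hsc, ?_, ?_,
    fun x hx => hx.1.1.1, hBn p, hp', fun x hx => hx.1.2, fun x hx y hy => ?_⟩
  · rw [hν, Measure.map_apply (hdm _) hsc.measurableSet.compl]
    exact measure_mono_null (fun x hx hxK => hx ⟨x, hxK, rfl⟩) hνK₁
  · rintro _ ⟨y, hy, rfl⟩ z hz
    refine (hrδ ?_ z hz).le
    have h1 := hdil ((n : ℝ) + 1)⁻¹ y 1
    rw [map_one, abs_of_pos hn0] at h1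
    rw [h1]
    refine lt_of_le_of_lt ?_ hn
    exact mul_le_mul_of_nonneg_left (hR hy) hn0.le
  · have h1 : dist x (u p.2) ≤ δ / 2 := hx.2
    have h2 : dist y (u p.2) ≤ δ / 2 := hy.2
    linarith [dist_triangle_right x y (u p.2)]

/-- A Borel set that is not an Aronszajn union is charged by a convolution of absolutely continuous
measures. -/
theorem exists_cac_ne_zero [CompleteSpace G]
    (hdil : ∀ (t : ℝ) (p q : G), dist (S.dil t p) (S.dil t q) = |t| * dist p q)
    (hX : S.IsCarnotSpanning X) {E : Set G} (hE : MeasurableSet E)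
    (hEX : ¬ S.IsAronszajnUnion X E) : ∃ μ ∈ S.CAC X, μ E ≠ 0 := by
  obtain ⟨C, hC, hCm, hCu, hCE⟩ := hE.exists_covers
  -- The thresholds decrease strictly, to leave room at each step, stay above `1/2`, and start at
  -- `5/6 < 1`, below the mass of the initial Dirac measure.
  let c : ℕ → ℝ≥0∞ := fun k => 2⁻¹ + ((k + 3 : ℕ) : ℝ≥0∞)⁻¹
  have hclt : ∀ k, c (k + 1) < c k := fun k => by
    refine ENNReal.add_lt_add_left (by simp) (ENNReal.inv_lt_inv.2 ?_)
    exact_mod_cast (by omega)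
  have hc2 : ∀ k, 2⁻¹ ≤ c k := fun k => le_self_add
  have hc0 : c 0 < 1 := by
    calc c 0 < 2⁻¹ + 2⁻¹ := ENNReal.add_lt_add_left (by simp) (ENNReal.inv_lt_inv.2 (by norm_num))
      _ = 1 := ENNReal.inv_two_add_inv_two
  -- The state consists of the target set `A`, the set `B` of admissible base points, the
  -- convolution `ρ` so far, and a compact set containing `1` and the partial products.
  let Inv : ℕ → Set G × Set G × Measure G × Set G → Prop := fun k t =>
    MeasurableSet t.1 ∧ MeasurableSet t.2.1 ∧ ¬ S.IsAronszajnUnion X t.2.1 ∧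
      IsProbabilityMeasure t.2.2.1 ∧ IsCompact t.2.2.2 ∧ 1 ∈ t.2.2.2 ∧
      ∀ x ∈ t.2.1, c k < t.2.2.1 {y | x * y ∈ t.1}
  have hstep : ∀ (k : ℕ) (t : {t // Inv k t}), ∃ (t' : {t // Inv (k + 1) t}) (ν : Measure G)
      (s : Set G) (N : ℕ), ν ∈ ACMeasures (S.assocFiltration X k) ∧ IsProbabilityMeasure ν ∧
      ν sᶜ = 0 ∧ (∀ y ∈ s, ∀ z ∈ t.1.2.2.2, dist (y * z) z ≤ (1 / 2) ^ k ∧ y * z ∈ t'.1.2.2.2) ∧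
      t'.1.2.2.1 = ν.mconv t.1.2.2.1 ∧ t'.1.1 = t.1.1 ∩ C k N ∧ t'.1.2.1 ⊆ t.1.2.1 ∧
      ∀ x ∈ t'.1.2.1, ∀ y ∈ t'.1.2.1, dist x y ≤ (1 / 2) ^ k := by
    rintro k ⟨⟨A, B, ρ, K⟩, hA, hB, hBX, hρ, hK, h1K, hc⟩
    obtain ⟨ν, s, N, B', hν, hνp, hs, hνs, hsK, hB'B, hB', hB'X, hc', hB'd⟩ :=
      exists_next_measure hdil hX k hA hB hBX hK (hclt k) hc (hC k) (hCm k) (hCu k)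
        (show (0 : ℝ) < (1 / 2) ^ k by positivity)
    open Pointwise in
    refine ⟨⟨⟨A ∩ C k N, B', ν.mconv ρ, insert 1 (s * K)⟩, hA.inter (hC k N), hB', hB'X,
      inferInstance, (hs.mul hK).insert 1, Set.mem_insert _ _, hc'⟩, ν, s, N, hν, hνp, hνs,
      fun y hy z hz => ⟨hsK y hy z hz, Or.inr (Set.mul_mem_mul hy hz)⟩, rfl, rfl, hB'B, hB'd⟩
  choose f ν s N hν hνp hνs hsK hρ hA hB hBd using hstep
  let t₀ : {t // Inv 0 t} := ⟨⟨E, E, Measure.dirac 1, {1}⟩, hE, hE, hEX, inferInstance,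
    isCompact_singleton, rfl, fun x hx => by
      refine hc0.trans_le (le_of_eq ?_)
      exact (Measure.dirac_apply_of_mem (by simpa using hx)).symm⟩
  let t : ∀ k, {t // Inv k t} := fun k => Nat.rec t₀ (fun k t => f k t) k
  have ht : ∀ k, t (k + 1) = f k (t k) := fun k => rfl
  let ν' : ℕ → Measure G := fun k => ν k (t k)
  have hν'p : ∀ k, IsProbabilityMeasure (ν' k) := fun k => hνp k (t k)
  have hconv : ∀ k, (t (k + 1)).1.2.2.1 = convProd ν' 0 k := by
    intro k
    induction k with
    | zero =>
      rw [ht, hρ]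
      exact Measure.mconv_dirac_one _
    | succ k ih =>
      rw [ht, hρ, ih, convProd, zero_add]
  have hAsub : ∀ k, (t k).1.1 ⊆ E ∩ ⋂ i < k, C i (N i (t i)) := by
    intro k
    induction k with
    | zero => exact fun x hx => ⟨hx, by simp⟩
    | succ k ih =>
      rw [ht, hA]
      rintro x ⟨hx, hxC⟩
      refine ⟨(ih hx).1, Set.mem_iInter₂.2 fun i hi => ?_⟩
      rcases Nat.lt_succ_iff_lt_or_eq.1 hi with hi | rfl
      · exact Set.mem_iInter₂.1 (ih hx).2 i hi
      · exact hxC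
  have hne : ∀ k, ((t (k + 1)).1.2.1).Nonempty := fun k => by
    rw [Set.nonempty_iff_ne_empty]
    intro h
    exact (t (k + 1)).2.2.2.1 (h ▸ .empty)
  choose x hx using hne
  -- The sets of base points are nested with geometrically decreasing diameters.
  obtain ⟨g, hg⟩ : ∃ g, Tendsto x atTop (𝓝 g) := by
    refine cauchySeq_tendsto_of_complete (cauchySeq_of_le_geometric (1 / 2) 1 (by norm_num)
      fun k => ?_)
    rw [one_mul]
    refine hBd k (t k) _ (hx k) _ ?_
    have := hB (k + 1) (t (k + 1)) (hx (k + 1))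
    exact this
  obtain ⟨Z, hZ, hZlim, hZw⟩ := exists_limit_convProd ν' (s := fun k => s k (t k))
    (K := fun k => (t k).1.2.2.2) (fun k => (t k).2.2.2.2.2.2.1)
    (fun k y hy z hz => (hsK k (t k) y hy z hz).2) (fun k y hy z hz => (hsK k (t k) y hy z hz).1)
    (fun k => hνs k (t k))
  obtain ⟨μ, hμ, hμw⟩ := hZw 0
  refine ⟨_, ⟨g, μ, ⟨ν', fun k => hν k (t k), fun m => ?_, hμw⟩, rfl⟩, ?_⟩
  · obtain ⟨η, -, hη⟩ := hZw m
    exact ⟨η, hη⟩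
  have hD : ∀ k, MeasurableSet {ω : ℕ → G | x k * partialProd ω 0 k ∈ (t (k + 1)).1.1} := fun k =>
    ((measurable_const_mul (x k)).comp (measurable_partialProd 0 k)) (t (k + 1)).2.1
  have hDle : ∀ k, 2⁻¹ ≤ (Measure.infinitePi ν')
      {ω : ℕ → G | x k * partialProd ω 0 k ∈ (t (k + 1)).1.1} := fun k => by
    have h1 := (t (k + 1)).2.2.2.2.2.2.2 (x k) (hx k)
    rw [hconv, ← map_partialProd_infinitePi,
      Measure.map_apply (measurable_partialProd 0 k)
        (show MeasurableSet {y | x k * y ∈ (t (k + 1)).1.1} from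
          measurable_const_mul (x k) (t (k + 1)).2.1)] at h1
    exact (hc2 _).trans h1.le
  -- Almost surely on this event the points `x k * partialProd ω 0 k` converge to `g * Z 0 ω` and
  -- satisfy the cover conditions infinitely often, so this limit lies in `E`.
  have hfreq := le_measure_frequently (Measure.infinitePi ν') hD hDle
  have hpos : (2⁻¹ : ℝ≥0∞) ≠ 0 := by simp
  rw [Measure.map_apply (measurable_const_mul g) hE, hμ,
    Measure.map_apply (hZ 0) (measurable_const_mul g hE)]
  refine fun h0 => hpos (le_antisymm (hfreq.trans ?_) zero_le)
  rw [← h0]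
  refine measure_mono_ae ?_
  filter_upwards [hZlim 0] with ω hω hωD
  refine hCE (fun i => N i (t i)) (fun k => x k * partialProd ω 0 k) _ (hg.mul hω) ?_
  refine hωD.mono fun k hk => ?_
  have h1 := hAsub (k + 1) hk
  exact ⟨h1.1, fun i hi => Set.mem_iInter₂.1 h1.2 i (by omega)⟩

end ScalableStructure

/-! ### The converse: CAC measures do not charge Aronszajn unions. -/

section Convolution

variable {G : Type*} [Group G] [MeasurableSpace G]

theorem isProbabilityMeasure_convProd [MeasurableMul₂ G] {ν : ℕ → Measure G}
    (hν : ∀ k, IsProbabilityMeasure (ν k)) (m n : ℕ) : IsProbabilityMeasure (convProd ν m n) := by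
  induction n with
  | zero => exact hν m
  | succ n ih => exact inferInstanceAs (IsProbabilityMeasure ((ν _).mconv _))

theorem convProd_add [MeasurableMul₂ G] {ν : ℕ → Measure G} (hν : ∀ k, IsProbabilityMeasure (ν k))
    (i n : ℕ) : convProd ν 0 (i + 1 + n) = (convProd ν (i + 1) n).mconv (convProd ν 0 i) := by
  have := isProbabilityMeasure_convProd hν
  induction n with
  | zero => simp [convProd]
  | succ n ih =>
    rw [convProd, Measure.mconv_assoc, ← ih, ← add_assoc, convProd, zero_add]

theorem mconv_compl_eq_zero [MeasurableMul₂ G] {μ ν : Measure G} [SFinite μ] [SFinite ν]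
    {H : Subgroup G} (hH : MeasurableSet (H : Set G)) (hμ : μ (H : Set G)ᶜ = 0)
    (hν : ν (H : Set G)ᶜ = 0) : (μ.mconv ν) (H : Set G)ᶜ = 0 := by
  rw [Measure.mconv, Measure.map_apply measurable_mul hH.compl]
  refine measure_mono_null (t := ((H : Set G)ᶜ ×ˢ Set.univ) ∪ (Set.univ ×ˢ (H : Set G)ᶜ)) ?_ ?_
  · rintro ⟨x, y⟩ hxy
    by_contra hcon
    simp only [Set.mem_union, Set.mem_prod, Set.mem_compl_iff, Set.mem_univ, and_true, true_and,
      not_or, not_not] at hcon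
    exact hxy (H.mul_mem hcon.1 hcon.2)
  · rw [measure_union_null_iff, Measure.prod_prod, Measure.prod_prod, hμ, hν]
    simp

theorem isProbabilityMeasure_of_mem_acMeasures [TopologicalSpace G] {H : Subgroup G}
    {ν : Measure G} (h : ν ∈ ACMeasures H) : IsProbabilityMeasure ν := by
  obtain ⟨_, ν', -, hν', -, rfl⟩ := h
  exact Measure.isProbabilityMeasure_map measurable_subtype_coe.aemeasurable

theorem compl_eq_zero_of_mem_acMeasures [TopologicalSpace G] {H : Subgroup G}
    (hH : MeasurableSet (H : Set G)) {ν : Measure G} (h : ν ∈ ACMeasures H) :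
    ν (H : Set G)ᶜ = 0 := by
  obtain ⟨_, ν', -, -, -, rfl⟩ := h
  rw [Measure.map_apply measurable_subtype_coe hH.compl]
  exact measure_mono_null (t := ∅) (fun h hh => hh h.2) measure_empty

/-- Convolution on the right is weakly continuous. -/
theorem TendstoWeakly.mconv_right [TopologicalSpace G] [IsTopologicalGroup G] [BorelSpace G]
    [MeasurableMul₂ G] [SecondCountableTopology G]
    {c : ℕ → Measure G} {η : ProbabilityMeasure G} (h : TendstoWeakly c η) (ρ : Measure G)
    [IsProbabilityMeasure ρ] :
    ∃ η' : ProbabilityMeasure G, (η' : Measure G) = (η : Measure G).mconv ρ ∧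
      TendstoWeakly (fun n => (c n).mconv ρ) η' := by
  obtain ⟨p, hp, hlim⟩ := h
  let p' : ℕ → ProbabilityMeasure G := fun n => ⟨(p n : Measure G).mconv ρ, inferInstance⟩
  let η' : ProbabilityMeasure G := ⟨(η : Measure G).mconv ρ, inferInstance⟩
  refine ⟨η', rfl, p', fun n => by
    change (p n : Measure G).mconv ρ = (c n).mconv ρ
    rw [hp], ?_⟩
  rw [ProbabilityMeasure.tendsto_iff_forall_integral_tendsto] at hlim ⊢
  intro f
  -- Testing the convolution against `f` is testing the left factor against this bounded continuous
  -- average.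
  have hcont : Continuous fun x => ∫ z, f (x * z) ∂ρ := by
    refine continuous_of_dominated (bound := fun _ => ‖f‖) (fun x => ?_) (fun x => ?_)
      (integrable_const _) (Eventually.of_forall fun z => by fun_prop)
    · exact (f.continuous.comp (continuous_const.mul continuous_id)).measurable.aestronglyMeasurable
    · exact Eventually.of_forall fun z => f.norm_coe_le_norm _
  let g : G →ᵇ ℝ := BoundedContinuousFunction.ofNormedAddCommGroup _ hcont ‖f‖ fun x => by
    refine (norm_integral_le_of_norm_le_const (Eventually.of_forall fun z =>
      f.norm_coe_le_norm _)).trans ?_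
    simp
  have hint : ∀ μ : Measure G, IsProbabilityMeasure μ → ∫ x, f x ∂(μ.mconv ρ) = ∫ x, g x ∂μ := by
    intro μ hμ
    rw [Measure.mconv, integral_map measurable_mul.aemeasurable
      f.continuous.measurable.aestronglyMeasurable, integral_prod]
    · rfl
    · exact Integrable.of_bound (C := ‖f‖)
        (f.continuous.measurable.comp measurable_mul).aestronglyMeasurable
        (Eventually.of_forall fun z => f.norm_coe_le_norm _)
  have := hlim g
  simp_rw [fun n => (hint (p n) inferInstance).symm] at this
  rw [(hint η inferInstance).symm] at this
  exact this

end Convolution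

namespace ScalableStructure

section

variable {G : Type*} [Group G] [TopologicalSpace G] [IsTopologicalGroup G]
  [MeasurableSpace G] [BorelSpace G] {S : ScalableStructure G}

/-- The sets of the class `𝒜(Y)` have Haar measure zero in every locally compact subgroup that
contains the one-parameter subgroup of `Y`. -/
theorem AronszajnClass.haar_eq_zero {H : Subgroup G} [LocallyCompactSpace H]
    [SecondCountableTopology H] (vol : Measure H) [vol.IsHaarMeasure] {Y : G}
    (hY : ∀ t, S.dil t Y ∈ H) {F : Set G} (hF : F ∈ S.AronszajnClass Y) :
    vol {h : H | (h : G) ∈ F} = 0 := by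
  have hFm : MeasurableSet {h : H | (h : G) ∈ F} := measurable_subtype_coe hF.1
  let γ : ℝ → H := fun t => ⟨S.dil t Y, hY t⟩
  have hγ : Measurable γ := (continuous_dil_left Y).measurable.subtype_mk
  have hm : MeasurableSet {p : H × ℝ | p.1 * γ p.2 ∈ {h : H | (h : G) ∈ F}} :=
    (measurable_fst.mul (hγ.comp measurable_snd)) hFm
  -- Every line in direction `Y` meets `F` in a null set of times. Fubini then gives a time `t` at
  -- which a right translate of `F` is Haar null.
  have h1 : (vol.prod volume) {p : H × ℝ | p.1 * γ p.2 ∈ {h : H | (h : G) ∈ F}} = 0 := by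
    rw [Measure.measure_prod_null hm]
    exact Eventually.of_forall fun h => hF.2 h
  rw [Measure.prod_apply_symm hm, lintegral_eq_zero_iff (measurable_measure_prodMk_right hm)] at h1
  obtain ⟨t, ht⟩ := h1.exists
  exact (measure_mul_right_null vol (γ t)).1 ht

theorem AronszajnClass.translate {Y : G} {F : Set G} (hF : F ∈ S.AronszajnClass Y) (x : G) :
    {z | x * z ∈ F} ∈ S.AronszajnClass Y := by
  refine ⟨measurable_const_mul x hF.1, fun g => ?_⟩
  have := hF.2 (x * g)
  simpa [mul_assoc] using this

variable [MeasurableMul₂ G]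

/-- The partial convolutions charge no set of the class of the last generator. -/
theorem convProd_aronszajnClass {X : ℕ → G} (hX : S.IsCarnotSpanning X) {ν : ℕ → Measure G}
    (hν : ∀ k, ν k ∈ ACMeasures (S.assocFiltration X k)) (i : ℕ) {F : Set G}
    (hF : F ∈ S.AronszajnClass (X i)) : convProd ν 0 i F = 0 := by
  have hcarnot : S.IsCarnotSubgroup (S.assocFiltration X i) := hX.2.1 i
  have hνp : ∀ k, IsProbabilityMeasure (ν k) := fun k => isProbabilityMeasure_of_mem_acMeasures (hν k)
  have hcp := isProbabilityMeasure_convProd hνp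
  obtain ⟨d, -, ε, -⟩ := IsCarnotSubgroup.exists_chart (S := S) (A := {g | ∃ j ≤ i, g = X j}) hcarnot
    (by rintro _ ⟨j, -, rfl⟩; exact hX.1 j)
  have hmeas : ∀ k, MeasurableSet (S.assocFiltration X k : Set G) := fun k =>
    (hX.2.1 k).1.1.measurableSet
  have hmonoH : Monotone (S.assocFiltration X) := monotone_nat_of_le_succ hX.2.2.1
  change (Fin d → ℝ) ≃ₜ S.assocFiltration X i at ε
  have hYH : ∀ t, S.dil t (X i) ∈ S.assocFiltration X i := fun t =>
    subset_closure (Subgroup.subset_closure ⟨X i, ⟨i, le_rfl, rfl⟩, t, rfl⟩)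
  -- The earlier factors live on smaller subgroups, hence on `H_i`; for `i = 0` there are none and
  -- `σ` is the Dirac measure at `1`.
  obtain ⟨σ, hσp, hσH, hσ⟩ : ∃ σ : Measure G, IsProbabilityMeasure σ ∧
      σ (S.assocFiltration X i : Set G)ᶜ = 0 ∧ convProd ν 0 i = (ν i).mconv σ := by
    cases i with
    | zero =>
      refine ⟨Measure.dirac 1, inferInstance, ?_, ?_⟩
      · rw [Measure.dirac_apply' _ (hmeas 0).compl]
        simp
      · rw [Measure.mconv_dirac_one]; rfl
    | succ i =>
      refine ⟨convProd ν 0 i, inferInstance, ?_, by rw [convProd, zero_add]⟩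
      have : ∀ j ≤ i + 1, convProd ν 0 j (S.assocFiltration X (i + 1) : Set G)ᶜ = 0 := by
        intro j
        have hνj : ∀ j ≤ i + 1, ν j (S.assocFiltration X (i + 1) : Set G)ᶜ = 0 := fun j hj =>
          measure_mono_null (Set.compl_subset_compl.2 (hmonoH hj))
            (compl_eq_zero_of_mem_acMeasures (hmeas j) (hν j))
        induction j with
        | zero => exact hνj 0
        | succ j ih =>
          intro hj
          rw [convProd, zero_add]
          exact mconv_compl_eq_zero (hmeas _) (hνj _ hj) (ih (by omega))
      exact this i (by omega)
  have : LocallyCompactSpace (S.assocFiltration X i) := ε.symm.isClosedEmbedding.locallyCompactSpace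
  have : SecondCountableTopology (S.assocFiltration X i) := ε.symm.secondCountableTopology
  obtain ⟨vol, ν', hvol, hν'p, hac, hνi⟩ := hν i
  have hms : MeasurableSet {p : G × G | p.1 * p.2 ∈ F} := measurable_mul hF.1
  have hnull : ∀ᵐ z ∂σ, ν i {y | y * z ∈ F} = 0 := by
    have hae : ∀ᵐ z ∂σ, z ∈ S.assocFiltration X i := by rw [ae_iff]; exact hσH
    filter_upwards [hae] with z hz
    have hm : MeasurableSet {y | y * z ∈ F} := measurable_mul_const z hF.1
    rw [hνi, Measure.map_apply measurable_subtype_coe hm]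
    refine hac ?_
    exact (measure_mul_right_null vol ⟨z, hz⟩).2 (AronszajnClass.haar_eq_zero vol hYH hF)
  rw [hσ, Measure.mconv, Measure.map_apply measurable_mul hF.1]
  change ((ν i).prod σ) {p : G × G | p.1 * p.2 ∈ F} = 0
  rw [Measure.prod_apply_symm hms]
  exact lintegral_eq_zero_of_ae_eq_zero hnull

end

section Metric

variable {G : Type*} [Group G] [MetricSpace G] [IsTopologicalGroup G] [MeasurableSpace G]
  [BorelSpace G] {S : ScalableStructure G}

/-- Convergence of the tails `ν_k * ... * ν_{i+1}` lets the limit be split after index `i`. The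
class `𝒜(X i)` is translation invariant, so the inner factor `ν_i * ... * ν_0` vanishes on every
translate of `F i`. -/
theorem cac_eq_zero_of_isAronszajnUnion [SecondCountableTopology G] {X : ℕ → G}
    (hX : S.IsCarnotSpanning X) {E : Set G} (hE : S.IsAronszajnUnion X E) {μ : Measure G}
    (hμ : μ ∈ S.CAC X) : μ E = 0 := by
  obtain ⟨g, μ, ⟨ν, hν, hη, hμ⟩, rfl⟩ := hμ
  obtain ⟨F, rfl, hF⟩ := hE
  have hνp : ∀ k, IsProbabilityMeasure (ν k) := fun k => isProbabilityMeasure_of_mem_acMeasures (hν k)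
  have hcp := isProbabilityMeasure_convProd hνp
  rw [measure_iUnion_null_iff]
  intro i
  rw [Measure.map_apply (measurable_const_mul g) (hF i).1]
  obtain ⟨η, hη⟩ := hη (i + 1)
  obtain ⟨η', hη', p, hp, hplim⟩ := hη.mconv_right (convProd ν 0 i)
  obtain ⟨q, hq, hqlim⟩ := hμ
  have hqp : ∀ n, q (n + (i + 1)) = p n := fun n => by
    apply Subtype.ext
    have h1 : (p n : Measure G) = (convProd ν (i + 1) n).mconv (convProd ν 0 i) := hp n
    have h2 : (q (n + (i + 1)) : Measure G) = _ := hq (n + (i + 1))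
    rw [add_comm n, convProd_add hνp, ← h1, add_comm] at h2
    exact h2
  have hlim := hqlim.comp (tendsto_add_atTop_nat (i + 1))
  have heq := tendsto_nhds_unique (hlim.congr fun n => hqp n) hplim
  rw [heq]
  change (η' : Measure G) {z | g * z ∈ F i} = 0
  rw [hη', mconv_translate _ _ (hF i).1]
  refine lintegral_eq_zero_of_ae_eq_zero (Eventually.of_forall fun y => ?_)
  exact convProd_aronszajnClass hX hν i (AronszajnClass.translate (hF i) (g * y))

omit [IsTopologicalGroup G] [MeasurableSpace G] [BorelSpace G] in
theorem IsCarnotSubgroup.isSeparable {H : Subgroup G} (hH : S.IsCarnotSubgroup H) :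
    TopologicalSpace.IsSeparable (H : Set G) := by
  obtain ⟨-, L, _, _, _, _, _, _, _, V, e, -, -⟩ := hH
  let φ := (Module.finBasis ℝ L).equivFun
  have hφ : Continuous φ.symm := LinearMap.continuous_of_finiteDimensional φ.symm.toLinearMap
  have hcont : Continuous fun v => (e (φ.symm v) : G) :=
    continuous_subtype_val.comp (e.continuous.comp hφ)
  refine (TopologicalSpace.isSeparable_range hcont).mono fun h hh => ⟨φ (e.symm ⟨h, hh⟩), by simp⟩

omit [IsTopologicalGroup G] [MeasurableSpace G] [BorelSpace G] in
-- Carnot subgroups are continuous images of Euclidean spaces, so the filtration makes the group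
-- separable. With completeness this makes it Polish, and multiplication is jointly Borel
-- measurable.
theorem IsInfDimCarnotGroup.secondCountableTopology (hG : S.IsInfDimCarnotGroup) :
    SecondCountableTopology G := by
  obtain ⟨N, hN, -, hdense⟩ := hG.exists_filtration
  have h := (TopologicalSpace.IsSeparable.iUnion fun m => (hN m).isSeparable).closure
  rw [hdense] at h
  have := TopologicalSpace.isSeparable_univ_iff.1 h
  exact UniformSpace.secondCountable_of_separable G

end Metric

end ScalableStructure

end

theorem mainTheorem1 {G : Type*} [Group G] [MetricSpace G] [IsTopologicalGroup G]
    [MeasurableSpace G] [BorelSpace G] (S : ScalableStructure G) (hG : S.IsInfDimCarnotGroup)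
    (E : Set G) (hE : MeasurableSet E) :
    S.AronszajnNull E ↔ S.CACNull E := by
  have := hG.secondCountableTopology
  have := hG.complete
  refine ⟨fun h X hX μ hμ => ScalableStructure.cac_eq_zero_of_isAronszajnUnion hX (h X hX) hμ,
    fun h X hX => ?_⟩
  by_contra hEX
  obtain ⟨μ, hμ, hμE⟩ := ScalableStructure.exists_cac_ne_zero hG.dist_dil hX hE hEX
  exact hμE (h X hX μ hμ)
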